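/- \textbf{Setting.} Consider complex variables $t=(t_1,t_3,t_5,\dots)$, and give the space $\mathbb{C}^{\mathbb{N}}$ of all sequences $t$ the finite topology: a set is open iff, for every $n$ and every fixing of the variables $t_{2n+1},t_{2n+3},\dots$, its slice in the remaining variables $t_1,\dots,t_{2n-1}$ is open in $\mathbb{C}^n$. Let $\Omega$ be open and connected in this topology (for example $\mathbb{C}^\infty=\bigcup_n\mathbb{C}^n$, or any connected open subset of it). A function on $\Omega$ is called \emph{differentiable} if, with all but finitely many variables fixed, it is a holomorphic function of the remaining ones. Write $\partial_{2k+1}=\partial/\partial t_{2k+1}$, and let a prime denote $\partial_1$. Let $v_2,v_4,v_6,\dots$ be an infinite sequence of differentiable functions on $\Omega$. Put $$L=\partial_1^2-v_2,\qquad B_{2k+1}=\partial_{2k-1}\partial_1^2-\tfrac12\,(v_2\partial_{2k-1}+\partial_{2k-1}v_2)-\tfrac14\,(v_{2k}\partial_1+\partial_1v_{2k})-\partial_{2k+1}\qquad(k\ge1),$$ considered as operators on the differentiable functions on $\Omega$, where a function also denotes the operator of multiplication by it. \textbf{KdV hierarchy.} Let $\mathcal{H}=\mathbb{C}[u,u',u'',\dots]$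 with the derivation $\partial_z\colon u^{(j)}\mapsto u^{(j+1)}$ and the grading $\operatorname{wt}u^{(j)}=j+2$. For $k\ge0$ let $A_{2k+1}$ be the unique operator of the form $$A_{2k+1}=\partial_z^{2k+1}+\sum_{j=1}^k\bigl(\alpha_{2j}\,\partial_z^{2k-2j+1}+\partial_z^{2k-2j+1}\alpha_{2j}\bigr),\qquad \alpha_{2j}\in\mathcal{H}\ \text{homogeneous of weight } 2j,$$ such that $[\partial_z^2-u,A_{2k+1}]$ is the multiplication by an element of $\mathcal{H}$. For constants $a=(a_4,a_6,\dots)$, the parametric Korteweg--de Vries hierarchy with parameters $a$ is the system $$\frac{\partial u}{\partial t_{2k+1}}=\Bigl[\partial_z^2-u,\;A_{2k+1}+\sum_{j=0}^{k-2}a_{2k-2j}A_{2j+1}\Bigr],\qquad k\ge1,\quad z=t_1.$$ \textbf{Recursion.} For constants $\mu=(\mu_4,\mu_6,\dots)$ define differential polynomials $T_k\in\mathcal{H}$ by $T_1=u$ and $T_k=\frac14\varepsilon_{2k}-\mu_{2k}$ for $k\ge2$, where $$\sum_{k\ge1}\varepsilon_{2k}\xi^k=\xi\,\beta_2^2+2\xi\,\beta_3(1-\beta_1)+4\beta_1^2+4u\,\xi\,(1-\beta_1)^2,$$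 $$\beta_1=\tfrac12\sum_{i\ge1}T_i\xi^i,\qquad \beta_2=\tfrac12\sum_{i\ge1}\partial_z(T_i)\,\xi^i,\qquad \beta_3=\tfrac12\sum_{i\ge1}\partial_z^2(T_i)\,\xi^i$$ (for $k\ge2$ the coefficient $\varepsilon_{2k}$ involves only $T_1,\dots,T_{k-1}$). \textbf{Theorem.} The following conditions are equivalent: (i) the operators $L,B_3,B_5,B_7,\dots$ commute with each other; (ii) $\dfrac{\partial v_2}{\partial t_{2k+1}}=\dfrac{\partial v_{2k+2}}{\partial t_1}$ for all $k\ge1$, and there are constants $\mu_4,\mu_6,\dots$ such that the functions $$\mathbf b_1(\xi)=\tfrac12\sum_{i\ge1}v_{2i}\xi^i,\quad \mathbf b_2(\xi)=\tfrac12\sum_{i\ge1}v_{2i}'\xi^i,\quad \mathbf b_3(\xi)=\tfrac12\sum_{i\ge1}v_{2i}''\xi^i,\quad \mathbf m(\xi)=\xi^{-1}+\sum_{i\ge1}\mu_{2i+2}\xi^i$$ satisfy, as formal Laurent series in $\xi$ at every point of $\Omega$, $$4\mathbf m(\xi)=\mathbf b_2(\xi)^2+2\mathbf b_3(\xi)(1-\mathbf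 b_1(\xi))+4(\xi^{-1}+v_2)(1-\mathbf b_1(\xi))^2;$$ (iii) there are constants $a_4,a_6,\dots$ such that $u=v_2$ solves the parametric Korteweg--de Vries hierarchy with parameters $a$, and, for all $k\ge2$, the function $v_{2k}$ is obtained from $T_k$ by substituting $v_2$ for $u$ and $\partial_1$ for $\partial_z$, where the constants $\mu$ are given by $$\mu_{2k+2}=2a_{2k+2}+\sum_{i=1}^{k-2}a_{2i+2}\,a_{2k-2i},\qquad k\ge1.$$ -/

import Mathlib

open scoped ContDiff

noncomputable section

namespace KdV

/-! ### Functions of the variables `t₁, t₃, t₅, …` -/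

/-- Sequences `t = (t₁, t₃, t₅, …)` of complex numbers; `t k` stands for `t_{2k+1}`. -/
def Times : Type := ℕ → ℂ

/-- The sequence whose first `n` entries are those of `s`; all the others are those of `t`. -/
def slice (t : Times) (n : ℕ) (s : Fin n → ℂ) : Times :=
  fun k => if h : k < n then s ⟨k, h⟩ else t k

/-- The finite topology (inductive limit topology of the finite-dimensional coordinate slices):
a set is open iff it meets every slice, in which finitely many of the variables vary and the others
are fixed, in an open subset of `ℂⁿ`. -/
instance : TopologicalSpace Times :=
  ⨆ (t : Times) (n : ℕ), TopologicalSpace.coinduced (slice t n) inferInstance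

/-- `f` is a differentiable function on the open set `Ω`: with all but finitely many variables
fixed, it is a holomorphic function of the remaining ones. (Over `ℂ`, on open subsets of `ℂⁿ`,
differentiable, analytic and `C^∞` mean the same.) -/
def Holo (Ω : Set Times) (f : Times → ℂ) : Prop :=
  ∀ (t : Times) (n : ℕ), ContDiffOn ℂ ∞ (fun s => f (slice t n s)) (slice t n ⁻¹' Ω)

/-- The partial derivative `∂_{2k+1} = ∂ / ∂t_{2k+1}`. -/
def pd (k : ℕ) (f : Times → ℂ) : Times → ℂ :=
  fun t => deriv (fun z => f (Function.update (t : ℕ → ℂ) k z)) (t k)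

/-! ### The Schrödinger and the Buchstaber–Shorina operators

In a sequence `v`, the function `v k` stands for `v_{2k}`, `k ≥ 1`; `v 0` is never used. -/

/-- `L = ∂₁² - v₂`. -/
def opL (v : ℕ → Times → ℂ) (φ : Times → ℂ) : Times → ℂ :=
  pd 0 (pd 0 φ) - v 1 * φ

/-- `B_{2k+1} = ∂_{2k-1} ∂₁² - ½ (v₂ ∂_{2k-1} + ∂_{2k-1} v₂) - ¼ (v_{2k} ∂₁ + ∂₁ v_{2k}) - ∂_{2k+1}`,
for `k ≥ 1`. -/
def opB (v : ℕ → Times → ℂ) (k : ℕ) (φ : Times → ℂ) : Times → ℂ :=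
  pd (k - 1) (pd 0 (pd 0 φ))
    - (1 / 2 : ℂ) • (v 1 * pd (k - 1) φ + pd (k - 1) (v 1 * φ))
    - (1 / 4 : ℂ) • (v k * pd 0 φ + pd 0 (v k * φ))
    - pd k φ

/-- Two operators commute on the functions that are holomorphic on `Ω`. -/
def CommuteOn (Ω : Set Times) (P Q : (Times → ℂ) → Times → ℂ) : Prop :=
  ∀ φ : Times → ℂ, Holo Ω φ → ∀ t ∈ Ω, P (Q φ) t = Q (P φ) t

/-- The operators `L, B₃, B₅, …` commute with each other. -/
def AllCommute (Ω : Set Times) (v : ℕ → Times → ℂ) : Prop :=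
  (∀ k, 1 ≤ k → CommuteOn Ω (opL v) (opB v k)) ∧
    ∀ j k, 1 ≤ j → 1 ≤ k → CommuteOn Ω (opB v j) (opB v k)

/-! ### The generating functions -/

/-- The formal series `½ ∑_{i ≥ 1} w_i ξ^i`. -/
def genSeries (w : ℕ → ℂ) : LaurentSeries ℂ :=
  HahnSeries.ofPowerSeries ℤ ℂ (PowerSeries.mk fun i => if i = 0 then 0 else (1 / 2) * w i)

/-- `𝐛₁(ξ) = ½ ∑_{i ≥ 1} v_{2i} ξ^i` at the point `t`. -/
def b₁ (v : ℕ → Times → ℂ) (t : Times) : LaurentSeries ℂ := genSeries fun i => v i t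

/-- `𝐛₂(ξ) = ½ ∑_{i ≥ 1} v_{2i}' ξ^i` at the point `t`. -/
def b₂ (v : ℕ → Times → ℂ) (t : Times) : LaurentSeries ℂ := genSeries fun i => pd 0 (v i) t

/-- `𝐛₃(ξ) = ½ ∑_{i ≥ 1} v_{2i}'' ξ^i` at the point `t`. -/
def b₃ (v : ℕ → Times → ℂ) (t : Times) : LaurentSeries ℂ := genSeries fun i => pd 0 (pd 0 (v i)) t

/-- `ξ⁻¹`. -/
def ξinv : LaurentSeries ℂ := HahnSeries.single (-1) 1

/-- `𝐦(ξ) = ξ⁻¹ + ∑_{i ≥ 1} μ_{2i+2} ξ^i`, where `μ k` stands for `μ_{2k}`, `k ≥ 2`. -/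
def mSeries (μ : ℕ → ℂ) : LaurentSeries ℂ :=
  ξinv + HahnSeries.ofPowerSeries ℤ ℂ (PowerSeries.mk fun i => if i = 0 then 0 else μ (i + 1))

/-- `4𝐦 = 𝐛₂² + 2𝐛₃(1 - 𝐛₁) + 4(ξ⁻¹ + v₂)(1 - 𝐛₁)²`, at every point of `Ω`. -/
def GenRelation (Ω : Set Times) (v : ℕ → Times → ℂ) (μ : ℕ → ℂ) : Prop :=
  ∀ t ∈ Ω, 4 * mSeries μ = b₂ v t ^ 2 + 2 * b₃ v t * (1 - b₁ v t)
    + 4 * (ξinv + HahnSeries.C (v 1 t)) * (1 - b₁ v t) ^ 2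

/-! ### Differential polynomials and the parametric KdV hierarchy -/

/-- The algebra `ℋ = ℂ[u, u', u'', …]`; the variable `X j` is `u^{(j)}`. -/
abbrev DiffPoly : Type := MvPolynomial ℕ ℂ

/-- The derivation `∂_z` of `ℋ`, `u^{(j)} ↦ u^{(j+1)}`. -/
def dz : Derivation ℂ DiffPoly DiffPoly :=
  MvPolynomial.mkDerivation ℂ fun j => MvPolynomial.X (j + 1)

/-- `p` is homogeneous of weight `n`, where `wt u^{(j)} = j + 2`. -/
def HasWeight (p : DiffPoly) (n : ℕ) : Prop :=
  MvPolynomial.IsWeightedHomogeneous (fun j : ℕ => j + 2) p n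

/-- Substitution of a function `u` for the free variable `u`, with `z = t₁`. -/
def subst (u : Times → ℂ) (p : DiffPoly) : Times → ℂ :=
  fun t => MvPolynomial.eval (fun j => ((pd 0)^[j] u) t) p

/-- `∂_z` as a linear operator. -/
def opDz : Module.End ℂ DiffPoly := (dz : DiffPoly →ₗ[ℂ] DiffPoly)

/-- The operator of multiplication by `p`. -/
def opMul (p : DiffPoly) : Module.End ℂ DiffPoly := LinearMap.mulLeft ℂ p

/-- `L = ∂_z² - u`, with `u` a free variable. -/
def formalL : Module.End ℂ DiffPoly := opDz ^ 2 - opMul (MvPolynomial.X 0)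

/-- `A` is the operator `A_{2k+1}`: it has the form
`∂_z^{2k+1} + ∑_{j=1}^k (α_{2j} ∂_z^{2k-2j+1} + ∂_z^{2k-2j+1} α_{2j})` with `α_{2j} ∈ ℋ` homogeneous
of weight `2j`, and `[L, A] ∈ ℋ`, that is, `[L, A]` is the multiplication by an element of `ℋ`. -/
def IsLaxOperator (k : ℕ) (A : Module.End ℂ DiffPoly) : Prop :=
  (∃ α : ℕ → DiffPoly, (∀ j ∈ Finset.Icc 1 k, HasWeight (α j) (2 * j)) ∧
    A = opDz ^ (2 * k + 1) + ∑ j ∈ Finset.Icc 1 k,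
      (opMul (α j) * opDz ^ (2 * k - 2 * j + 1) + opDz ^ (2 * k - 2 * j + 1) * opMul (α j))) ∧
  ∃ r : DiffPoly, ⁅formalL, A⁆ = opMul r

/-- The operator `A_{2k+1}`, uniquely determined by the property above. -/
def opA (k : ℕ) : Module.End ℂ DiffPoly := Classical.epsilon (IsLaxOperator k)

/-- The differential polynomial `[L, A_{2k+1} + ∑_{j=0}^{k-2} a_{2k-2j} A_{2j+1}]`, where `a k` stands
for `a_{2k}`, `k ≥ 2`. (The commutator is the multiplication by an element of `ℋ`, which is its value
at `1`.) -/
def kdvRhs (a : ℕ → ℂ) (k : ℕ) : DiffPoly :=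
  ⁅formalL, opA k + ∑ j ∈ Finset.range (k - 1), a (k - j) • opA j⁆ 1

/-- `u` solves the parametric KdV hierarchy with the parameters `a`:
`∂u/∂t_{2k+1} = [L, A_{2k+1} + ∑_{j=0}^{k-2} a_{2k-2j} A_{2j+1}]` for `k ≥ 1`. -/
def SolvesKdV (Ω : Set Times) (u : Times → ℂ) (a : ℕ → ℂ) : Prop :=
  ∀ k, 1 ≤ k → ∀ t ∈ Ω, pd k u t = subst u (kdvRhs a k) t

/-! ### The recursion for `v_{2k}` -/

/-- The series `∑ w_i ξ^i / 2` over `i ≥ 1` with coefficients in `ℋ`. -/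
def polySeries (w : ℕ → DiffPoly) : PowerSeries DiffPoly :=
  PowerSeries.mk fun i => if i = 0 then 0 else (1 / 2 : ℂ) • w i

/-- The series `∑ ε_{2k} ξ^k = ξ 𝐛₂² + 2ξ 𝐛₃ (1 - 𝐛₁) + 4 𝐛₁² + 4 v₂ ξ (1 - 𝐛₁)²` for a sequence `w`
of differential polynomials, where `w i` stands for `v_{2i}`, `i ≥ 1`. -/
def epsSeries (w : ℕ → DiffPoly) : PowerSeries DiffPoly :=
  PowerSeries.X * polySeries (fun i => dz (w i)) ^ 2
    + 2 * PowerSeries.X * polySeries (fun i => dz (dz (w i))) * (1 - polySeries w)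
    + 4 * polySeries w ^ 2
    + 4 * PowerSeries.C (w 1) * PowerSeries.X * (1 - polySeries w) ^ 2

/-- The polynomials `T_k`: `T_1 = u`, and `T_k = ¼ ε_{2k} - μ_{2k}` for `k ≥ 2`, where `ε_{2k}`
involves only `T_1, …, T_{k-1}`. (`T 0` is never used.) -/
def T (μ : ℕ → ℂ) : ℕ → DiffPoly
  | 0 => 0
  | 1 => MvPolynomial.X 0
  | k + 2 =>
    (1 / 4 : ℂ) • PowerSeries.coeff (k + 2)
        (epsSeries fun i => if _ : i < k + 2 then T μ i else 0)
      - MvPolynomial.C (μ (k + 2))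

/-! ### The three conditions -/

/-- `∂v₂/∂t_{2k+1} = ∂v_{2k+2}/∂t₁` for `k ≥ 1`, and the generating function relation holds with some
constants `μ_{2k}`. -/
def ConditionGen (Ω : Set Times) (v : ℕ → Times → ℂ) : Prop :=
  (∀ k, 1 ≤ k → ∀ t ∈ Ω, pd k (v 1) t = pd 0 (v (k + 1)) t) ∧
    ∃ μ : ℕ → ℂ, GenRelation Ω v μ

/-- `v₂` solves the parametric KdV hierarchy with some parameters `a_{2k}`, and
`v_{2k} = T_k(v₂, v₂', …, μ)` for `k ≥ 2`, where
`μ_{2k+2} = 2 a_{2k+2} + ∑_{i=1}^{k-2} a_{2i+2} a_{2k-2i}` for `k ≥ 1`. -/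
def ConditionKdV (Ω : Set Times) (v : ℕ → Times → ℂ) : Prop :=
  ∃ a : ℕ → ℂ, SolvesKdV Ω (v 1) a ∧
    ∃ μ : ℕ → ℂ,
      (∀ k, 1 ≤ k →
        μ (k + 1) = 2 * a (k + 1) + ∑ i ∈ Finset.Icc 1 (k - 2), a (i + 1) * a (k - i)) ∧
      ∀ k, 2 ≤ k → ∀ t ∈ Ω, v k t = subst (v 1) (T μ k) t

end KdV

end

/-! Put `G = 1 - ½ ∑ v_{2i} ξ^i` and `F(G) = ξ G'² - 2ξ G G'' + 4(1 + ξ v₂) G²`. Multiplied by `ξ`,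
the relation in (ii) says that `F(G)/4` is a series of constants. Its coefficients of `ξ⁰` and `ξ¹`
are 1 and 0 for every `v`, so on a connected open set the relation means only that every `∂_{2k+1}`
kills `F(G)`.

(i) ⇔ (ii), `ringCommute_iff`. Commutation of `L` with all the `B_{2k+1}` amounts to `∂_{2k+1} v₂ =
v_{2k+2}'` together with the Lenard recursion for the `v_{2k}`, that is, `F(G)' = 0`. Commutation of
the `B`'s with each other then gives two relations between derivatives of the coefficients of `G`;
iterating them yields the flows `ξ^k ∂_{2k+1} G = A G' - A' G`, where `A` is the truncation of `G`
to degree `k`. Finally `ξ^k ∂_{2k+1} F(G)` is the linearisation of `F` at `G`, applied to the defect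
`ξ^k ∂_{2k+1} G - (A G' - A' G)` (`X_pow_mul_serD_quadForm`). This linearisation is injective
because its lowest term in `ξ` is multiplication by 8. Hence the flows hold exactly if `F(G)` is
constant.

(ii) ⇔ (iii). For a given right-hand side, `F(G) = 4c` has at most one solution with constant term 1
(`quadForm_injective`), and the recursion for `T_k` solves it in `ℋ` (`quadForm_T`); so the relation
is equivalent to `v_{2k} = T_k(v₂)`. With `g_i` the coefficients of the solution for `μ = 0`, the
operators `∑ (g_i ∂ - ½ g_i') L^{k-i}` have the symmetric shape required of `A_{2k+1}`, and their
commutator with `L` is `-2 g_{k+1}'`; by uniqueness they are the `A_{2k+1}`. Since `F` is quadratic,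
the solution for general `μ` is the one for `μ = 0` times the square root of `1 + ∑ μ_{2i} ξ^i`,
whose coefficients are the `a_{2i}`. So the right-hand sides of the parametric hierarchy are the
`T_{k+1}'` (`kdvRhs_eq`), and the hierarchy becomes `∂_{2k+1} v₂ = v_{2k+2}'`.

The algebra takes place in rings with commuting derivations. It is applied to the ring of
holomorphic functions on `Ω`, where `t₁` is an element with derivative 1. -/

open scoped ContDiff

noncomputable section

namespace KdV

open PowerSeries

/-! ### The quadratic form, the Lenard operator and the flow equations -/

section Series

variable {R : Type*} [CommRing R] [Algebra ℂ R]

/-- The coefficientwise extension of a derivation to formal power series. -/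
def serD (d : Derivation ℂ R R) : Derivation ℂ R⟦X⟧ R⟦X⟧ :=
  Derivation.mk'
    { toFun := fun f => PowerSeries.mk fun n => d (coeff n f)
      map_add' := fun f g => by ext n; simp
      map_smul' := fun c f => by ext n; simp }
    (fun f g => by
      ext n
      simp only [LinearMap.coe_mk, AddHom.coe_mk, coeff_mk, coeff_mul, map_sum, smul_eq_mul,
        map_add, Derivation.leibniz, Finset.sum_add_distrib]
      congr 1
      rw [← Finset.Nat.sum_antidiagonal_swap]
      rfl)

@[simp] lemma coeff_serD (d : Derivation ℂ R R) (f : R⟦X⟧) (n : ℕ) :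
    coeff n (serD d f) = d (coeff n f) := by
  simp [serD]

@[simp] lemma serD_X (d : Derivation ℂ R R) : serD d (X : R⟦X⟧) = 0 := by
  ext n
  simp only [coeff_serD, coeff_X]
  split_ifs <;> simp

@[simp] lemma serD_C (d : Derivation ℂ R R) (r : R) : serD d (C r) = C (d r) := by
  ext n
  simp only [coeff_serD, coeff_C]
  split_ifs <;> simp

lemma derivation_map_ofNat {S : Type*} [CommRing S] [Algebra ℂ S] (d : Derivation ℂ S S)
    (n : ℕ) [n.AtLeastTwo] : d (OfNat.ofNat n : S) = 0 :=
  d.map_natCast n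

lemma serD_X_pow_mul (d : Derivation ℂ R R) (n : ℕ) (f : R⟦X⟧) :
    serD d (X ^ n * f) = X ^ n * serD d f := by
  simp [Derivation.leibniz, Derivation.leibniz_pow]

lemma serD_comm {d e : Derivation ℂ R R} (h : ∀ x, d (e x) = e (d x)) (f : R⟦X⟧) :
    serD d (serD e f) = serD e (serD d f) := by
  ext n; simp [h]

/-- `ξ G'² - 2 ξ G G'' + 4 (1 + ξ v) G²`. -/
def quadForm (d : Derivation ℂ R R) (v : R) (G : R⟦X⟧) : R⟦X⟧ :=
  X * serD d G ^ 2 - 2 * X * G * serD d (serD d G) + 4 * (1 + X * C v) * G ^ 2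

/-- The linearisation of `quadForm` at `G`. -/
def quadLin (d : Derivation ℂ R R) (v : R) (G Z : R⟦X⟧) : R⟦X⟧ :=
  2 * X * serD d G * serD d Z - 2 * X * Z * serD d (serD d G)
    - 2 * X * G * serD d (serD d Z) + 8 * (1 + X * C v) * G * Z

/-- The Lenard operator `ξ A''' - 4 (1 + ξ v) A' - 2 ξ v' A`. -/
def lenard (d : Derivation ℂ R R) (v : R) (A : R⟦X⟧) : R⟦X⟧ :=
  X * serD d (serD d (serD d A)) - 4 * (1 + X * C v) * serD d A - 2 * X * C (d v) * A

/-- The Wronskian `A G' - A' G`. -/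
def wronskian (d : Derivation ℂ R R) (A G : R⟦X⟧) : R⟦X⟧ := A * serD d G - serD d A * G

/-- The form is a first integral of the Lenard equation, so its constancy in `t₁` encodes the Lenard
recursion. -/
lemma serD_quadForm (d : Derivation ℂ R R) (v : R) (G : R⟦X⟧) :
    serD d (quadForm d v G) = -2 * G * lenard d v G := by
  have h2 : serD d (2 : R⟦X⟧) = 0 := derivation_map_ofNat _ 2
  have h4 : serD d (4 : R⟦X⟧) = 0 := derivation_map_ofNat _ 4
  simp only [quadForm, lenard, map_add, map_sub, Derivation.leibniz, Derivation.leibniz_pow,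
    smul_eq_mul, serD_X, serD_C, h2, h4, Derivation.map_one_eq_zero]
  ring

lemma serD_quadForm_of_comm {d e : Derivation ℂ R R} (h : ∀ x, e (d x) = d (e x)) (v : R)
    (G : R⟦X⟧) :
    serD e (quadForm d v G) = quadLin d v G (serD e G) + 4 * X * C (e v) * G ^ 2 := by
  have h2 : serD e (2 : R⟦X⟧) = 0 := derivation_map_ofNat _ 2
  have h4 : serD e (4 : R⟦X⟧) = 0 := derivation_map_ofNat _ 4
  simp only [quadForm, quadLin, map_add, map_sub, Derivation.leibniz, Derivation.leibniz_pow,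
    smul_eq_mul, serD_X, serD_C, h2, h4, Derivation.map_one_eq_zero, serD_comm h]
  ring

/-- If `G` satisfies the Lenard equation, the linearisation at a Wronskian sees `A` only through its
Lenard defect. For a truncation `A` of `G` this defect is a single monomial in `ξ`. -/
lemma quadLin_wronskian (d : Derivation ℂ R R) (v : R) (A G : R⟦X⟧) :
    quadLin d v G (wronskian d A G) = 2 * G ^ 2 * lenard d v A - 2 * A * G * lenard d v G := by
  simp only [wronskian, lenard, quadLin, map_add, map_sub, Derivation.leibniz,
    smul_eq_mul]
  ring

lemma quadLin_X_pow_mul (d : Derivation ℂ R R) (v : R) (G Z : R⟦X⟧) (n : ℕ) :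
    quadLin d v G (X ^ n * Z) = X ^ n * quadLin d v G Z := by
  simp only [quadLin, serD_X_pow_mul]; ring

lemma quadLin_sub (d : Derivation ℂ R R) (v : R) (G Y Z : R⟦X⟧) :
    quadLin d v G (Y - Z) = quadLin d v G Y - quadLin d v G Z := by
  simp only [quadLin, map_sub]; ring

lemma quadForm_mul_of_const (d : Derivation ℂ R R) (v : R) {c : R⟦X⟧} (hc : serD d c = 0)
    (G : R⟦X⟧) : quadForm d v (c * G) = c ^ 2 * quadForm d v G := by
  simp only [quadForm, Derivation.leibniz, smul_eq_mul, hc, map_add, map_zero]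
  ring

/-- A linear differential equation whose leading term in `ξ` is algebraic has only the trivial
solution. -/
lemma eq_zero_of_linear (d : Derivation ℂ R R) {a b c Z : R⟦X⟧}
    (ha : IsUnit (constantCoeff a))
    (h : a * Z + X * (b * serD d Z + c * serD d (serD d Z)) = 0) : Z = 0 := by
  -- `Z` is divisible by every power of `ξ`: after division by `ξ^n` the constant term of the
  -- equation reads `a(0) W(0) = 0`.
  have key : ∀ n : ℕ, (X : R⟦X⟧) ^ n ∣ Z := by
    intro n
    induction n with
    | zero => simp
    | succ n ih =>
      obtain ⟨W, rfl⟩ := ih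
      simp only [serD_X_pow_mul] at h
      have h' : X ^ n * (a * W + X * (b * serD d W + c * serD d (serD d W))) = 0 := by
        rw [← h]; ring
      have h2 : a * W + X * (b * serD d W + c * serD d (serD d W)) = 0 := by
        ext m
        have := congrArg (coeff (m + n)) h'
        rwa [coeff_X_pow_mul] at this
      have h3 := congrArg constantCoeff h2
      simp only [map_add, map_mul, constantCoeff_X, zero_mul, add_zero, map_zero] at h3
      have h4 : constantCoeff W = 0 := ha.mul_right_eq_zero.mp h3
      obtain ⟨V, rfl⟩ := X_dvd_iff.mpr h4
      exact ⟨V, by ring⟩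
  ext n
  exact X_pow_dvd_iff.mp (key (n + 1)) n n.lt_succ_self

lemma isUnit_ofNat_of_algebra (n : ℕ) [n.AtLeastTwo] : IsUnit (OfNat.ofNat n : R) := by
  have h : IsUnit (OfNat.ofNat n : ℂ) := isUnit_iff_ne_zero.mpr (OfNat.ofNat_ne_zero n)
  have h' := h.map (algebraMap ℂ R)
  rwa [map_ofNat] at h'

lemma eq_zero_of_quadLin (d : Derivation ℂ R R) (v : R) {G Z : R⟦X⟧}
    (hG : constantCoeff G = 1) (h : quadLin d v G Z = 0) : Z = 0 := by
  refine eq_zero_of_linear d (a := 8 * (1 + X * C v) * G - 2 * X * serD d (serD d G))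
    (b := 2 * serD d G) (c := -2 * G) ?_ ?_
  · simp only [map_sub, map_mul, map_add, map_one, constantCoeff_X, hG, map_ofNat]
    simpa using isUnit_ofNat_of_algebra (R := R) 8
  · rw [← h, quadLin]; ring

/-- The equation `quadForm G = c` has at most one solution with constant term `1`. -/
lemma quadForm_injective (d : Derivation ℂ R R) (v : R) {G H : R⟦X⟧}
    (hG : constantCoeff G = 1) (hH : constantCoeff H = 1)
    (h : quadForm d v G = quadForm d v H) : G = H := by
  rw [← sub_eq_zero]
  -- The difference of the two forms is linear in `Z = G - H`; the coefficients come from `G² - H² =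
  -- (G + H) Z` and `G G'' - H H'' = G'' Z + H Z''`.
  refine eq_zero_of_linear d
    (a := 4 * (1 + X * C v) * (G + H) - 2 * X * serD d (serD d G))
    (b := serD d G + serD d H) (c := -2 * H) ?_ ?_
  · simp only [map_sub, map_mul, map_add, map_one, constantCoeff_X, hG, hH, map_ofNat]
    have : IsUnit (8 : R) := isUnit_ofNat_of_algebra 8
    convert this using 1
    ring
  · rw [← sub_eq_zero] at h
    rw [← h, quadForm, quadForm, map_sub, map_sub]; ring

lemma isUnit_of_constantCoeff_eq_one {S : Type*} [CommRing S] {G : S⟦X⟧} (hG : constantCoeff G = 1) : IsUnit G := by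
  rw [isUnit_iff_constantCoeff, hG]; exact isUnit_one

lemma lenard_eq_zero (d : Derivation ℂ R R) (v : R) {G : R⟦X⟧} (hG : constantCoeff G = 1)
    (h : serD d (quadForm d v G) = 0) : lenard d v G = 0 := by
  rw [serD_quadForm] at h
  have h2 : IsUnit (-2 * G) := by
    refine IsUnit.mul ?_ (isUnit_of_constantCoeff_eq_one hG)
    exact (isUnit_ofNat_of_algebra (R := R⟦X⟧) 2).neg
  exact h2.mul_right_eq_zero.mp h

lemma coeff_succ_lenard (d : Derivation ℂ R R) (v : R) (A : R⟦X⟧) (n : ℕ) :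
    coeff (n + 1) (lenard d v A) = d (d (d (coeff n A))) - 4 * d (coeff (n + 1) A)
      - 4 * v * d (coeff n A) - 2 * d v * coeff n A := by
  have e : lenard d v A = X * (serD d (serD d (serD d A)) - C (4 * v) * serD d A
      - C (2 * d v) * A) - C 4 * serD d A := by
    simp only [lenard, map_mul, map_ofNat]; ring
  rw [e]
  simp only [map_sub, coeff_succ_X_mul, coeff_C_mul, coeff_serD]
  ring

lemma coeff_zero_lenard (d : Derivation ℂ R R) (v : R) (A : R⟦X⟧) :
    coeff 0 (lenard d v A) = - 4 * d (coeff 0 A) := by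
  have e : lenard d v A = X * (serD d (serD d (serD d A)) - C (4 * v) * serD d A
      - C (2 * d v) * A) - C 4 * serD d A := by
    simp only [lenard, map_mul, map_ofNat]; ring
  rw [e, map_sub, coeff_zero_X_mul, coeff_C_mul, coeff_serD]
  ring

/-- The truncation of a series to degree at most `k`. -/
def truncLE (k : ℕ) (G : R⟦X⟧) : R⟦X⟧ := PowerSeries.mk fun n => if n ≤ k then coeff n G else 0

/-- The Lenard operator couples only neighbouring coefficients, so cutting a solution at degree `k`
leaves one uncancelled term, the missing `-4 g_{k+1}'`. -/
lemma lenard_truncLE (d : Derivation ℂ R R) (v : R) {G : R⟦X⟧} (h : lenard d v G = 0) (k : ℕ) :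
    lenard d v (truncLE k G) = 4 * X ^ (k + 1) * C (d (coeff (k + 1) G)) := by
  ext n
  have e : (4 * X ^ (k + 1) * C (d (coeff (k + 1) G)) : R⟦X⟧) =
      X ^ (k + 1) * C (4 * d (coeff (k + 1) G)) := by
    simp only [map_mul, map_ofNat]; ring
  rw [e, coeff_X_pow_mul', coeff_C]
  cases n with
  | zero =>
    have := congrArg (coeff 0) h
    rw [coeff_zero_lenard] at this
    simpa [coeff_zero_lenard, truncLE] using this
  | succ n =>
    have := congrArg (coeff (n + 1)) h
    rw [coeff_succ_lenard, map_zero] at this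
    simp only [coeff_succ_lenard, truncLE, coeff_mk]
    rcases lt_trichotomy n k with hn | hn | hn
    · rw [if_pos hn.le, if_pos (by omega), if_neg (by omega)]; exact this
    · subst hn
      rw [if_pos le_rfl, if_neg (by omega), if_pos le_rfl, if_pos (by omega), map_zero]
      linear_combination this
    · rw [if_neg (by omega), if_neg (by omega), if_pos (by omega), if_neg (by omega)]
      simp

/-- The coefficient `g_i g_j' - g_i' g_j`. -/
def wr (d : Derivation ℂ R R) (g : ℕ → R) (i j : ℕ) : R := g i * d (g j) - d (g i) * g j

lemma wr_swap (d : Derivation ℂ R R) (g : ℕ → R) (i j : ℕ) : wr d g i j = - wr d g j i := by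
  simp only [wr]; ring

/-- `∑_{i < k} (g_i g_{m-i}' - g_i' g_{m-i})`. -/
def wrSum (d : Derivation ℂ R R) (g : ℕ → R) (k m : ℕ) : R :=
  ∑ i ∈ Finset.range k, wr d g i (m - i)

lemma eq_zero_of_eq_neg {x : R} (h : x = -x) : x = 0 := by
  have h2 : (2 : R) * x = 0 := by linear_combination h
  exact (isUnit_ofNat_of_algebra 2).mul_right_eq_zero.mp h2

lemma wrSum_full (d : Derivation ℂ R R) (g : ℕ → R) (m : ℕ) : wrSum d g (m + 1) m = 0 := by
  apply eq_zero_of_eq_neg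
  conv_lhs => rw [wrSum, ← Finset.sum_range_reflect]
  rw [wrSum, ← Finset.sum_neg_distrib]
  refine Finset.sum_congr rfl fun i hi => ?_
  rw [Finset.mem_range] at hi
  rw [wr_swap]
  congr 2; omega

/-- The full sum over `i ≤ j + k` vanishes by antisymmetry, and its part with `i ≥ j`, reversed, is
minus the right-hand side. This is the compatibility of different flows. -/
lemma wrSum_symm (d : Derivation ℂ R R) (g : ℕ → R) (j k : ℕ) :
    wrSum d g j (j + k) = wrSum d g (k + 1) (j + k) := by
  have h := wrSum_full d g (j + k)
  have h1 : wrSum d g (j + k + 1) (j + k) = wrSum d g j (j + k) +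
      ∑ i ∈ Finset.range (k + 1), wr d g (j + i) (j + k - (j + i)) := by
    rw [wrSum, add_assoc, Finset.sum_range_add]; rfl
  have h2 : ∑ i ∈ Finset.range (k + 1), wr d g (j + i) (j + k - (j + i)) =
      - wrSum d g (k + 1) (j + k) := by
    rw [← Finset.sum_range_reflect, wrSum, ← Finset.sum_neg_distrib]
    refine Finset.sum_congr rfl fun i hi => ?_
    rw [Finset.mem_range] at hi
    rw [wr_swap]
    congr 2 <;> omega
  rw [h1, h2] at h
  linear_combination h

lemma coeff_wronskian_truncLE (d : Derivation ℂ R R) (G : R⟦X⟧) (k m : ℕ) (h : k ≤ m) :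
    coeff m (wronskian d (truncLE k G) G) = wrSum d (fun n => coeff n G) (k + 1) m := by
  simp only [wronskian, map_sub, coeff_mul, coeff_serD, truncLE, coeff_mk,
    Finset.Nat.sum_antidiagonal_eq_sum_range_succ_mk, ← Finset.sum_sub_distrib]
  have : m.succ = (k + 1) + (m - k) := by omega
  rw [this, Finset.sum_range_add, wrSum]
  conv_rhs => rw [← add_zero (∑ i ∈ _, _)]
  congr 1
  · refine Finset.sum_congr rfl fun i hi => ?_
    rw [Finset.mem_range] at hi
    rw [if_pos (by omega), wr]
  · refine Finset.sum_eq_zero fun i hi => ?_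
    rw [if_neg (by omega)]
    simp

/-- Up to degree `k` the truncation is invisible, and the Wronskian of `G` with itself is zero. -/
lemma coeff_wronskian_truncLE_of_le (d : Derivation ℂ R R) (G : R⟦X⟧) (k m : ℕ) (h : m ≤ k) :
    coeff m (wronskian d (truncLE k G) G) = 0 := by
  rw [← wrSum_full d (fun n => coeff n G) m]
  simp only [wronskian, map_sub, coeff_mul, coeff_serD, truncLE, coeff_mk,
    Finset.Nat.sum_antidiagonal_eq_sum_range_succ_mk, ← Finset.sum_sub_distrib, wrSum]
  refine Finset.sum_congr rfl fun i hi => ?_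
  rw [Finset.mem_range] at hi
  rw [if_pos (by omega), wr]

/-- The flow equation `ξ^k ∂_k G = A G' - A' G`, with `A` the truncation of `G`, in coefficients. -/
lemma flow_iff (d e : Derivation ℂ R R) (G : R⟦X⟧) (k : ℕ) :
    X ^ k * serD e G = wronskian d (truncLE k G) G ↔
      ∀ n, e (coeff n G) = wrSum d (fun n => coeff n G) (k + 1) (n + k) := by
  constructor
  · intro h n
    have := congrArg (coeff (n + k)) h
    rwa [coeff_X_pow_mul, coeff_serD, coeff_wronskian_truncLE _ _ _ _ (by omega)] at this
  · intro h
    ext m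
    rw [coeff_X_pow_mul']
    split_ifs with hm
    · rw [coeff_serD, h, coeff_wronskian_truncLE _ _ _ _ hm, Nat.sub_add_cancel hm]
    · rw [coeff_wronskian_truncLE_of_le _ _ _ _ (by omega)]

/-- The term `4ξ^{k+1} (∂v) G²`, which arises because `F` itself depends on `v`, is exactly
cancelled by the Lenard defect of the truncation. What remains is the linearisation applied to the
defect of the flow equation. -/
lemma X_pow_mul_serD_quadForm {d e : Derivation ℂ R R} (h : ∀ x, e (d x) = d (e x)) (v : R)
    {G : R⟦X⟧} (k : ℕ) (hL : lenard d v G = 0) (hv : e v = -2 * d (coeff (k + 1) G)) :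
    X ^ k * serD e (quadForm d v G) =
      quadLin d v G (X ^ k * serD e G - wronskian d (truncLE k G) G) := by
  rw [quadLin_sub, quadLin_X_pow_mul, quadLin_wronskian, lenard_truncLE d v hL, hL,
    serD_quadForm_of_comm h, hv]
  simp only [map_mul, map_neg, map_ofNat]
  ring

lemma flow_of_serD_quadForm {d e : Derivation ℂ R R} (h : ∀ x, e (d x) = d (e x)) (v : R)
    {G : R⟦X⟧} (k : ℕ) (hG : constantCoeff G = 1)
    (hL : lenard d v G = 0) (hv : e v = -2 * d (coeff (k + 1) G))
    (hF : serD e (quadForm d v G) = 0) :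
    X ^ k * serD e G = wronskian d (truncLE k G) G := by
  have := X_pow_mul_serD_quadForm h v k hL hv
  rw [hF, mul_zero] at this
  exact sub_eq_zero.mp (eq_zero_of_quadLin d v hG this.symm)

lemma serD_quadForm_of_flow {d e : Derivation ℂ R R} (h : ∀ x, e (d x) = d (e x)) (v : R)
    {G : R⟦X⟧} (k : ℕ)
    (hL : lenard d v G = 0) (hv : e v = -2 * d (coeff (k + 1) G))
    (hF : X ^ k * serD e G = wronskian d (truncLE k G) G) :
    serD e (quadForm d v G) = 0 := by
  have := X_pow_mul_serD_quadForm h v k hL hv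
  rw [hF, sub_self] at this
  ext n
  have h2 := congrArg (coeff (n + k)) this
  rw [coeff_X_pow_mul] at h2
  rw [h2]
  simp [quadLin]

end Series

/-! ### Commutators of `L` and the `B_{2k+1}` in a differential ring -/

section Operators

variable {R : Type*} [CommRing R] [Algebra ℂ R]

/-- The Schrödinger operator `d² - v` of a differential ring. -/
def schrodinger (d : Derivation ℂ R R) (v φ : R) : R := d (d φ) - v * φ

/-- The Buchstaber–Shorina operator of a differential ring. -/
def shorina (d D E : Derivation ℂ R R) (v w φ : R) : R :=
  D (d (d φ)) - (1 / 2 : ℂ) • (v * D φ + D (v * φ)) - (1 / 4 : ℂ) • (w * d φ + d (w * φ)) - E φ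

/-- Clearing the denominators lets the commutators be computed by `ring`; the factors 4 and 16 below
have no other meaning. -/
lemma four_mul_shorina (d D E : Derivation ℂ R R) (v w φ : R) :
    4 * shorina d D E v w φ = 4 * D (d (d φ)) - 4 * v * D φ - 2 * D v * φ - 2 * w * d φ
      - d w * φ - 4 * E φ := by
  have h4 : ∀ x : R, 4 * (1 / 4 : ℂ) • x = x := fun x => by
    rw [mul_smul_comm, ← smul_mul_assoc, Algebra.smul_def, ← map_ofNat (algebraMap ℂ R) 4,
      ← map_mul]
    norm_num
  have h2 : ∀ x : R, 4 * (1 / 2 : ℂ) • x = 2 * x := fun x => by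
    rw [mul_smul_comm, ← smul_mul_assoc, Algebra.smul_def, ← map_ofNat (algebraMap ℂ R) 4,
      ← map_mul, ← map_ofNat (algebraMap ℂ R) 2]
    norm_num
  simp only [shorina, mul_sub, h2, h4, Derivation.leibniz, smul_eq_mul]
  ring

lemma schrodinger_four_mul (d : Derivation ℂ R R) (v φ : R) :
    schrodinger d v (4 * φ) = 4 * schrodinger d v φ := by
  simp only [schrodinger, Derivation.leibniz, smul_eq_mul, derivation_map_ofNat d 4, mul_zero,
    add_zero]
  ring

lemma shorina_four_mul (d D E : Derivation ℂ R R) (v w φ : R) :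
    shorina d D E v w (4 * φ) = 4 * shorina d D E v w φ := by
  have : ∀ x : R, 4 * x = (4 : ℂ) • x := fun x => by
    rw [Algebra.smul_def, map_ofNat]
  simp only [this, shorina, Derivation.map_smul, mul_smul_comm, smul_sub, smul_add]
  module

lemma cancel_ofNat (n : ℕ) [n.AtLeastTwo] {x : R} (h : (OfNat.ofNat n : R) * x = 0) : x = 0 :=
  (isUnit_ofNat_of_algebra n).mul_right_eq_zero.mp h

lemma four_mul_comm_schrodinger_shorina {d D E : Derivation ℂ R R} (hD : ∀ x, D (d x) = d (D x))
    (hE : ∀ x, E (d x) = d (E x)) (v w φ : R) :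
    4 * (schrodinger d v (shorina d D E v w φ) - shorina d D E v w (schrodinger d v φ)) =
      4 * (D v - d w) * d (d φ) + 4 * d (D v - d w) * d φ
        + (2 * d (d (D v)) - 4 * v * D v - 2 * w * d v - d (d (d w)) - 4 * E v) * φ := by
  rw [mul_sub, ← schrodinger_four_mul, four_mul_shorina, four_mul_shorina]
  have h2 : d (2 : R) = 0 := derivation_map_ofNat _ 2
  have h4 : d (4 : R) = 0 := derivation_map_ofNat _ 4
  simp only [schrodinger, map_sub, map_add, Derivation.leibniz, smul_eq_mul, h2, h4, hD, hE]
  simp only [mul_zero, add_zero, map_zero]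
  ring

/-- The hypotheses `h1`, …, `h2'` are what commutation with `L` provides. Modulo them the commutator
depends on two functions only, `D w' - D' w` and `w * d w' - d w * w' + 2 * (E w' - E' w)`. -/
lemma sixteen_mul_comm_shorina {d D E D' E' : Derivation ℂ R R}
    (hD : ∀ x, D (d x) = d (D x)) (hE : ∀ x, E (d x) = d (E x))
    (hD' : ∀ x, D' (d x) = d (D' x)) (hE' : ∀ x, E' (d x) = d (E' x))
    (hDD : ∀ x, D' (D x) = D (D' x)) (hDE : ∀ x, D' (E x) = E (D' x))
    (hED : ∀ x, E' (D x) = D (E' x)) (hEE : ∀ x, E' (E x) = E (E' x))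
    (v w w' φ : R) (h1 : D v = d w) (h1' : D' v = d w')
    (h2 : 4 * E v = d (d (d w)) - 4 * v * d w - 2 * w * d v)
    (h2' : 4 * E' v = d (d (d w')) - 4 * v * d w' - 2 * w' * d v) :
    16 * (shorina d D E v w (shorina d D' E' v w' φ) - shorina d D' E' v w' (shorina d D E v w φ)) =
      -4 * schrodinger d v (2 * (D w' - D' w) * d φ + 3 * d (D w' - D' w) * φ)
        + 4 * (w * d w' - d w * w' + 2 * (E w' - E' w)) * d φ
        + 6 * d (w * d w' - d w * w' + 2 * (E w' - E' w)) * φ := by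
  have e : 16 * (shorina d D E v w (shorina d D' E' v w' φ)
      - shorina d D' E' v w' (shorina d D E v w φ)) =
      4 * shorina d D E v w (4 * shorina d D' E' v w' φ)
        - 4 * shorina d D' E' v w' (4 * shorina d D E v w φ) := by
    rw [shorina_four_mul, shorina_four_mul]; ring
  rw [e, four_mul_shorina d D' E' v w' φ, four_mul_shorina d D E v w φ, four_mul_shorina,
    four_mul_shorina]
  have c2 : ∀ δ : Derivation ℂ R R, δ (2 : R) = 0 := fun δ => derivation_map_ofNat _ 2
  have c3 : ∀ δ : Derivation ℂ R R, δ (3 : R) = 0 := fun δ => derivation_map_ofNat _ 3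
  have c4 : ∀ δ : Derivation ℂ R R, δ (4 : R) = 0 := fun δ => derivation_map_ofNat _ 4
  simp only [schrodinger, map_sub, map_add, Derivation.leibniz, smul_eq_mul, c2, c3, c4, hD, hE,
    hD', hE', hDD, hDE, hED, hEE, h1, h1']
  simp only [mul_zero, add_zero, zero_add, map_zero]
  linear_combination (4 * D' φ) * h2 - 4 * D φ * h2'

/-- A differential operator of order at most `3` that vanishes has zero coefficients. -/
lemma coeff_eq_zero_of_operator {d : Derivation ℂ R R} {τ : R} (hτ : d τ = 1) {p₃ p₂ p₁ p₀ : R}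
    (h : ∀ φ, p₃ * d (d (d φ)) + p₂ * d (d φ) + p₁ * d φ + p₀ * φ = 0) :
    p₃ = 0 ∧ p₂ = 0 ∧ p₁ = 0 ∧ p₀ = 0 := by
  -- Applied to `1`, `τ`, `τ²`, `τ³`, the operator reveals its coefficients one at a time, from
  -- order 0 upwards.
  have h0 := h 1
  have h1 := h τ
  have h2 := h (τ ^ 2)
  have h3 := h (τ ^ 3)
  have c2 : d (2 : R) = 0 := derivation_map_ofNat _ 2
  have c3 : d (3 : R) = 0 := derivation_map_ofNat _ 3
  simp only [Derivation.map_one_eq_zero, map_zero, mul_zero, zero_add, mul_one] at h0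
  subst h0
  simp only [hτ, Derivation.map_one_eq_zero, map_zero, mul_zero, zero_add, mul_one, add_zero,
    zero_mul] at h1
  subst h1
  have e1 : d (τ ^ 2) = 2 * τ := by rw [pow_two, Derivation.leibniz, hτ, smul_eq_mul]; ring
  have e2 : d (2 * τ) = 2 := by simp [Derivation.leibniz, hτ, c2]
  rw [e1, e2, c2] at h2
  have h2' : p₂ = 0 := cancel_ofNat 2 (by linear_combination h2)
  subst h2'
  have f1 : d (τ ^ 3) = 3 * τ ^ 2 := by
    rw [pow_succ, Derivation.leibniz, hτ, e1]; simp only [smul_eq_mul]; ring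
  have f2 : d (3 * τ ^ 2) = 3 * (2 * τ) := by simp [Derivation.leibniz, e1, c3]
  have f3 : d (3 * (2 * τ)) = 6 := by
    rw [Derivation.leibniz, e2, c3]; simp only [smul_eq_mul]; ring
  rw [f1, f2, f3] at h3
  exact ⟨cancel_ofNat 6 (by linear_combination h3), rfl, rfl, rfl⟩

lemma commute_schrodinger_shorina_iff {d D E : Derivation ℂ R R} {τ : R} (hτ : d τ = 1)
    (hD : ∀ x, D (d x) = d (D x)) (hE : ∀ x, E (d x) = d (E x)) (v w : R) :
    (∀ φ, schrodinger d v (shorina d D E v w φ) = shorina d D E v w (schrodinger d v φ)) ↔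
      D v = d w ∧ 4 * E v = d (d (d w)) - 4 * v * d w - 2 * w * d v := by
  have key := four_mul_comm_schrodinger_shorina hD hE v w
  constructor
  · intro h
    have h' : ∀ φ, 0 * d (d (d φ)) + 4 * (D v - d w) * d (d φ) + 4 * d (D v - d w) * d φ
        + (2 * d (d (D v)) - 4 * v * D v - 2 * w * d v - d (d (d w)) - 4 * E v) * φ = 0 := by
      intro φ
      have := key φ
      rw [h φ, sub_self] at this
      linear_combination -this
    obtain ⟨-, h2, -, h0⟩ := coeff_eq_zero_of_operator hτ h'
    have e := sub_eq_zero.mp (cancel_ofNat 4 h2)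
    rw [e] at h0
    exact ⟨e, by linear_combination -h0⟩
  · rintro ⟨h1, h2⟩ φ
    refine sub_eq_zero.mp (cancel_ofNat 4 ?_)
    rw [key φ, h1, sub_self, map_zero]
    linear_combination -φ * h2

lemma commute_shorina_iff {d D E D' E' : Derivation ℂ R R} {τ : R} (hτ : d τ = 1)
    (hD : ∀ x, D (d x) = d (D x)) (hE : ∀ x, E (d x) = d (E x))
    (hD' : ∀ x, D' (d x) = d (D' x)) (hE' : ∀ x, E' (d x) = d (E' x))
    (hDD : ∀ x, D' (D x) = D (D' x)) (hDE : ∀ x, D' (E x) = E (D' x))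
    (hED : ∀ x, E' (D x) = D (E' x)) (hEE : ∀ x, E' (E x) = E (E' x))
    {v w w' : R} (h1 : D v = d w) (h1' : D' v = d w')
    (h2 : 4 * E v = d (d (d w)) - 4 * v * d w - 2 * w * d v)
    (h2' : 4 * E' v = d (d (d w')) - 4 * v * d w' - 2 * w' * d v) :
    (∀ φ, shorina d D E v w (shorina d D' E' v w' φ) =
        shorina d D' E' v w' (shorina d D E v w φ)) ↔
      D w' = D' w ∧ 2 * (E' w - E w') = w * d w' - d w * w' := by
  have key := fun φ =>
    sixteen_mul_comm_shorina hD hE hD' hE' hDD hDE hED hEE v w w' φ h1 h1' h2 h2'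
  have c2 : d (2 : R) = 0 := derivation_map_ofNat _ 2
  have c3 : d (3 : R) = 0 := derivation_map_ofNat _ 3
  constructor
  · intro h
    set S := D w' - D' w with hS
    set ρ := w * d w' - d w * w' + 2 * (E w' - E' w) with hρ
    have h' : ∀ φ, (-8 * S) * d (d (d φ)) + (-28 * d S) * d (d φ)
        + (-32 * d (d S) + 8 * v * S + 4 * ρ) * d φ
        + (-12 * d (d (d S)) + 12 * v * d S + 6 * d ρ) * φ = 0 := by
      intro φ
      have := key φ
      rw [h φ, sub_self] at this
      simp only [schrodinger, map_add, Derivation.leibniz, smul_eq_mul, c2, c3, mul_zero,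
        add_zero] at this
      linear_combination -this
    -- The third-order coefficient gives `S = 0`; the first-order one is then `4ρ`. The other two
    -- carry no further information.
    obtain ⟨h3, -, h4, -⟩ := coeff_eq_zero_of_operator hτ h'
    have hS0 : S = 0 := cancel_ofNat 8 (by linear_combination -h3)
    rw [hS0] at h4
    have hρ0 : ρ = 0 := cancel_ofNat 4 (by simpa using h4)
    exact ⟨sub_eq_zero.mp hS0, by linear_combination hρ - hρ0⟩
  · rintro ⟨h3, h4⟩ φ
    refine sub_eq_zero.mp (cancel_ofNat 16 ?_)
    rw [key φ, h3, sub_self]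
    have : w * d w' - d w * w' + 2 * (E w' - E' w) = 0 := by linear_combination -h4
    rw [this]
    simp [schrodinger]

/-- The series `1 - ½ ∑_{i ≥ 1} v_i ξ^i`. -/
def gSeries (v : ℕ → R) : R⟦X⟧ := 1 - PowerSeries.mk fun i => if i = 0 then 0 else (1 / 2 : ℂ) • v i

lemma constantCoeff_gSeries (v : ℕ → R) : constantCoeff (gSeries v) = 1 := by
  rw [← coeff_zero_eq_constantCoeff_apply]; simp [gSeries]

lemma coeff_zero_gSeries (v : ℕ → R) : coeff 0 (gSeries v) = 1 := by simp [gSeries]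

lemma coeff_gSeries (v : ℕ → R) {i : ℕ} (h : 1 ≤ i) :
    coeff i (gSeries v) = -((1 / 2 : ℂ) • v i) := by
  simp [gSeries, coeff_one, Nat.one_le_iff_ne_zero.mp h]

lemma eq_neg_two_mul_coeff_gSeries (v : ℕ → R) {i : ℕ} (h : 1 ≤ i) :
    v i = -2 * coeff i (gSeries v) := by
  rw [coeff_gSeries v h, neg_mul_neg, mul_smul_comm, ← smul_mul_assoc, Algebra.smul_def,
    ← map_ofNat (algebraMap ℂ R) 2, ← map_mul]
  norm_num

/-- The operators `L, B₃, B₅, …` of a differential ring commute with each other. -/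
def RingCommute (D : ℕ → Derivation ℂ R R) (v : ℕ → R) : Prop :=
  (∀ k, 1 ≤ k → ∀ φ, schrodinger (D 0) (v 1) (shorina (D 0) (D (k - 1)) (D k) (v 1) (v k) φ) =
    shorina (D 0) (D (k - 1)) (D k) (v 1) (v k) (schrodinger (D 0) (v 1) φ)) ∧
  ∀ j k, 1 ≤ j → 1 ≤ k → ∀ φ,
    shorina (D 0) (D (j - 1)) (D j) (v 1) (v j) (shorina (D 0) (D (k - 1)) (D k) (v 1) (v k) φ) =
    shorina (D 0) (D (k - 1)) (D k) (v 1) (v k) (shorina (D 0) (D (j - 1)) (D j) (v 1) (v j) φ)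

lemma lenard_gSeries_eq_zero_iff (d : Derivation ℂ R R) (v : ℕ → R) :
    lenard d (v 1) (gSeries v) = 0 ↔ ∀ k, 1 ≤ k → 4 * d (v (k + 1)) =
      d (d (d (v k))) - 4 * v 1 * d (v k) - 2 * v k * d (v 1) := by
  have c2 : d (-2 : R) = 0 := by rw [map_neg, derivation_map_ofNat _ 2, neg_zero]
  have e : ∀ x, d (-2 * x) = -2 * d x := fun x => by
    rw [Derivation.leibniz, c2, smul_zero, add_zero, smul_eq_mul]
  constructor
  · intro h k hk
    have := congrArg (coeff (k + 1)) h
    rw [coeff_succ_lenard, map_zero] at this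
    rw [eq_neg_two_mul_coeff_gSeries v hk, eq_neg_two_mul_coeff_gSeries v (Nat.le_add_left 1 k)]
    simp only [e]
    linear_combination 2 * this
  · intro h
    ext k
    rw [map_zero]
    match k with
    | 0 => rw [coeff_zero_lenard, coeff_zero_gSeries, Derivation.map_one_eq_zero, mul_zero]
    | 1 =>
      have h1 := eq_neg_two_mul_coeff_gSeries v le_rfl
      rw [coeff_succ_lenard, coeff_zero_gSeries, Derivation.map_one_eq_zero]
      simp only [map_zero, zero_add]
      rw [h1, e, ← h1]
      ring
    | k + 2 =>
      have := h (k + 1) (Nat.le_add_left 1 k)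
      rw [coeff_succ_lenard]
      refine cancel_ofNat 2 ?_
      conv at this =>
        rw [eq_neg_two_mul_coeff_gSeries v (Nat.le_add_left 1 k),
          eq_neg_two_mul_coeff_gSeries v (Nat.le_add_left 1 (k + 1))]
      simp only [e] at this
      linear_combination this

/-- The commutation of `L, B₃, B₅, …` is equivalent to `∂_k v₂ = ∂₁ v_{2k+2}` together with the
vanishing of all derivatives of the quadratic form of the generating series. -/
theorem ringCommute_iff {D : ℕ → Derivation ℂ R R} (hcomm : ∀ j k x, D j (D k x) = D k (D j x))
    {τ : R} (hτ : D 0 τ = 1) (v : ℕ → R) :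
    RingCommute D v ↔ (∀ k, 1 ≤ k → D k (v 1) = D 0 (v (k + 1))) ∧
      ∀ k, serD (D k) (quadForm (D 0) (v 1) (gSeries v)) = 0 := by
  set G := gSeries v with hGdef
  set g : ℕ → R := fun n => coeff n G with hg
  have hG : constantCoeff G = 1 := constantCoeff_gSeries v
  have hvg : ∀ i, 1 ≤ i → v i = -2 * g i := fun i hi => eq_neg_two_mul_coeff_gSeries v hi
  have hδ2 : ∀ δ : Derivation ℂ R R, ∀ x, δ (-2 * x) = -2 * δ x := fun δ x => by
    rw [Derivation.leibniz, map_neg, derivation_map_ofNat _ 2, neg_zero, smul_zero, add_zero,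
      smul_eq_mul]
  -- Commutation with `B_{2k+3}` gives `∂_{2k+1} v₂ = v_{2k+2}'`. Inserted into the second condition
  -- for `B_{2k+1}`, this becomes the Lenard recursion.
  have hLB : (∀ k, 1 ≤ k → ∀ φ,
      schrodinger (D 0) (v 1) (shorina (D 0) (D (k - 1)) (D k) (v 1) (v k) φ) =
      shorina (D 0) (D (k - 1)) (D k) (v 1) (v k) (schrodinger (D 0) (v 1) φ)) ↔
      (∀ k, D k (v 1) = D 0 (v (k + 1))) ∧ lenard (D 0) (v 1) G = 0 := by
    simp only [commute_schrodinger_shorina_iff hτ (fun x => hcomm _ 0 x) (fun x => hcomm _ 0 x),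
      hGdef, lenard_gSeries_eq_zero_iff]
    constructor
    · intro h
      have h1 : ∀ k, D k (v 1) = D 0 (v (k + 1)) := fun k => (h (k + 1) (Nat.le_add_left 1 k)).1
      exact ⟨h1, fun k hk => by rw [← h1]; exact (h k hk).2⟩
    · rintro ⟨h1, h2⟩ k hk
      refine ⟨?_, by rw [h1]; exact h2 k hk⟩
      rw [h1, Nat.sub_add_cancel hk]
  have hBB : (∀ k, D k (v 1) = D 0 (v (k + 1))) → lenard (D 0) (v 1) G = 0 →
      ∀ j k, 1 ≤ j → 1 ≤ k → ((∀ φ,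
      shorina (D 0) (D (j - 1)) (D j) (v 1) (v j)
        (shorina (D 0) (D (k - 1)) (D k) (v 1) (v k) φ) =
      shorina (D 0) (D (k - 1)) (D k) (v 1) (v k)
        (shorina (D 0) (D (j - 1)) (D j) (v 1) (v j) φ)) ↔
      D (j - 1) (g k) = D (k - 1) (g j) ∧ D j (g k) - D k (g j) = wr (D 0) g j k) := by
    intro h1 hL j k hj hk
    have hLn := (lenard_gSeries_eq_zero_iff (D 0) v).mp hL
    rw [commute_shorina_iff hτ (fun x => hcomm _ _ x) (fun x => hcomm _ _ x)
      (fun x => hcomm _ _ x) (fun x => hcomm _ _ x) (fun x => hcomm _ _ x)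
      (fun x => hcomm _ _ x) (fun x => hcomm _ _ x) (fun x => hcomm _ _ x)
      (by rw [h1, Nat.sub_add_cancel hj]) (by rw [h1, Nat.sub_add_cancel hk])
      (by rw [h1]; exact hLn j hj) (by rw [h1]; exact hLn k hk), hvg j hj, hvg k hk]
    simp only [hδ2, wr]
    constructor
    · rintro ⟨a, b⟩
      exact ⟨sub_eq_zero.mp (cancel_ofNat 2 (by linear_combination -a)),
        sub_eq_zero.mp (cancel_ofNat 4 (by linear_combination b))⟩
    · rintro ⟨a, b⟩
      exact ⟨by linear_combination -2 * a, by linear_combination 4 * b⟩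
  constructor
  · rintro ⟨hl, hb⟩
    obtain ⟨h1, hL⟩ := hLB.mp hl
    refine ⟨fun k _ => h1 k, fun k => ?_⟩
    have hb' := fun j k hj hk => (hBB h1 hL j k hj hk).mp (hb j k hj hk)
    have flow : ∀ k n, D k (g n) = wrSum (D 0) g (k + 1) (n + k) := by
      intro k
      induction k with
      | zero =>
        intro n
        simp [wrSum, wr, hg, hGdef, coeff_zero_gSeries]
      | succ k ih =>
        intro n
        cases n with
        | zero =>
          rw [zero_add, wrSum_full]
          simp [hg, hGdef, coeff_zero_gSeries]
        | succ n =>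
          -- Two of the relations form a ladder: `hr` trades `∂_{k+1} g_{n+1}` for `∂_{n+1} g_{k+1}`
          -- plus one Wronskian term, and `hs` replaces the latter by `∂_k g_{n+2}`, known by
          -- induction.
          obtain ⟨-, hr⟩ := hb' (k + 1) (n + 1) (by omega) (by omega)
          obtain ⟨hs, -⟩ := hb' (n + 2) (k + 1) (by omega) (by omega)
          have e1 : D (k + 1) (g (n + 1)) = D k (g (n + 2)) + wr (D 0) g (k + 1) (n + 1) := by
            have : D (n + 1) (g (k + 1)) = D k (g (n + 2)) := hs
            rw [← this]; linear_combination hr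
          have a1 : n + 2 + k = n + 1 + (k + 1) := by omega
          have a2 : n + 1 + (k + 1) - (k + 1) = n + 1 := by omega
          rw [e1, ih, a1]
          conv_rhs => rw [wrSum, Finset.sum_range_succ, ← wrSum, a2]
    refine serD_quadForm_of_flow (fun x => hcomm _ _ x) (v 1) k hL ?_
      ((flow_iff (D 0) (D k) G k).mpr (flow k))
    rw [h1, hvg (k + 1) (by omega), hδ2]
  · rintro ⟨h1, hF⟩
    have h1' : ∀ k, D k (v 1) = D 0 (v (k + 1)) := by
      intro k
      cases k with
      | zero => rfl
      | succ k => exact h1 _ (by omega)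
    have hL : lenard (D 0) (v 1) G = 0 := lenard_eq_zero _ _ hG (hF 0)
    refine ⟨hLB.mpr ⟨h1', hL⟩, fun j k hj hk => (hBB h1' hL j k hj hk).mpr ?_⟩
    have flow : ∀ k n, D k (g n) = wrSum (D 0) g (k + 1) (n + k) := by
      intro k
      rw [hg, ← flow_iff]
      refine flow_of_serD_quadForm (fun x => hcomm _ _ x) (v 1) k hG hL ?_ (hF k)
      rw [h1', hvg (k + 1) (by omega), hδ2]
    obtain ⟨j, rfl⟩ := Nat.exists_eq_add_of_le' hj
    obtain ⟨k, rfl⟩ := Nat.exists_eq_add_of_le' hk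
    -- Along the flows both relations become statements about partial Wronskian sums, which follow
    -- from `wrSum_symm`; in the second, two sums differ by their last term.
    simp only [Nat.add_sub_cancel, flow]
    constructor
    · have := wrSum_symm (D 0) g (j + 1) k
      rw [show k + 1 + j = j + 1 + k by omega, this]
    · have := wrSum_symm (D 0) g (j + 1) (k + 1)
      rw [show k + 1 + (j + 1) = j + 1 + (k + 1) by omega, ← this, wrSum,
        Finset.sum_range_succ, ← wrSum]
      rw [show j + 1 + (k + 1) - (j + 1) = k + 1 by omega]
      ring

end Operators

/-! ### The recursion for `T_k` and the change of parameters -/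

section Recursion

/-- The series `1 + ∑_{i ≥ 2} μ_i ξ^i`. -/
def muSeries (μ : ℕ → ℂ) : ℂ⟦X⟧ :=
  PowerSeries.mk fun i => if i = 0 then 1 else if i = 1 then 0 else μ i

lemma polySeries_eq (w : ℕ → DiffPoly) : polySeries w = 1 - gSeries w := by
  rw [gSeries, sub_sub_cancel, polySeries]

lemma serD_polySeries (w : ℕ → DiffPoly) :
    polySeries (fun i => dz (w i)) = serD dz (polySeries w) := by
  ext1 n
  simp only [polySeries, coeff_mk, coeff_serD]
  split_ifs <;> simp

/-- The series `ε` has `4 b²` where the form has `4 (1 - b)²`. The difference `4 - 8b` contributes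
the `-4 w_n` for which the recursion solves. -/
lemma epsSeries_eq (w : ℕ → DiffPoly) :
    epsSeries w = quadForm dz (w 1) (gSeries w) - 4 + 8 * polySeries w := by
  have e : gSeries w = 1 - polySeries w := by rw [polySeries_eq, sub_sub_cancel]
  rw [epsSeries, serD_polySeries, serD_polySeries (fun i => dz (w i)), serD_polySeries, e,
    quadForm]
  simp only [map_sub, Derivation.map_one_eq_zero, zero_sub, map_neg]
  ring

/-- The coefficient of `ξ^n` in `epsSeries w` depends only on `w_i` for `i < n`. -/
lemma coeff_epsSeries_congr {w w' : ℕ → DiffPoly} {n : ℕ} (hn : 2 ≤ n)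
    (h : ∀ i < n, w i = w' i) : coeff n (epsSeries w) = coeff n (epsSeries w') := by
  have h0 : ∀ w : ℕ → DiffPoly, (X : DiffPoly⟦X⟧) ∣ polySeries w := fun w => by
    rw [X_dvd_iff, ← coeff_zero_eq_constantCoeff_apply]; simp [polySeries]
  have h1 : (X : DiffPoly⟦X⟧) ^ n ∣ polySeries w - polySeries w' := by
    rw [X_pow_dvd_iff]
    intro m hm
    simp [polySeries, h m hm]
  obtain ⟨r, hr⟩ := h1
  obtain ⟨s, hs⟩ := h0 w
  obtain ⟨s', hs'⟩ := h0 w'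
  have hr' : polySeries w = polySeries w' + X ^ n * r := by rw [← hr]; ring
  have h2 : (X : DiffPoly⟦X⟧) ^ (n + 1) ∣ epsSeries w - epsSeries w' := by
    rw [epsSeries, epsSeries, serD_polySeries, serD_polySeries (fun i => dz (w i)),
      serD_polySeries, serD_polySeries, serD_polySeries (fun i => dz (w' i)), serD_polySeries,
      h 1 (by omega)]
    -- This is the only term without an explicit factor `ξ`; the extra power comes from `polySeries
    -- w + polySeries w'`, which has no constant term.
    have e4 : 4 * polySeries w ^ 2 - 4 * polySeries w' ^ 2 = X ^ (n + 1) * (4 * r * (s + s')) := by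
      have : 4 * polySeries w ^ 2 - 4 * polySeries w' ^ 2 =
        4 * (polySeries w - polySeries w') * (polySeries w + polySeries w') := by ring
      rw [this, hr, hs, hs']; ring
    have e5 : ∀ a b c a' b' c' : DiffPoly⟦X⟧, a + b + 4 * polySeries w ^ 2 + c
        - (a' + b' + 4 * polySeries w' ^ 2 + c') =
        (a + b + c - (a' + b' + c')) + X ^ (n + 1) * (4 * r * (s + s')) := by
      intro a b c a' b' c'; rw [← e4]; ring
    rw [e5]
    refine dvd_add ?_ (dvd_mul_right _ _)
    rw [hr']
    simp only [map_add, serD_X_pow_mul]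
    generalize polySeries w' = p
    generalize serD dz p = p'
    generalize serD dz p' = p''
    generalize serD dz r = r'
    generalize serD dz r' = r''
    refine ⟨2 * p' * r' + X ^ n * r' ^ 2 + 2 * r'' * (1 - p) - 2 * p'' * r - 2 * X ^ n * r * r''
      + 4 * C (w' 1) * (-2 * r * (1 - p) + X ^ n * r ^ 2), ?_⟩
    ring
  have := X_pow_dvd_iff.mp h2 n (Nat.lt_succ_self n)
  rw [map_sub] at this
  exact sub_eq_zero.mp this

lemma coeff_zero_epsSeries (w : ℕ → DiffPoly) : coeff 0 (epsSeries w) = 0 := by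
  simp [epsSeries, polySeries, coeff_zero_eq_constantCoeff]

lemma coeff_one_epsSeries (w : ℕ → DiffPoly) : coeff 1 (epsSeries w) = 4 * w 1 := by
  obtain ⟨s, hs⟩ : (X : DiffPoly⟦X⟧) ∣ polySeries w := by
    rw [X_dvd_iff, ← coeff_zero_eq_constantCoeff_apply]; simp [polySeries]
  have e : epsSeries w = X * (C (4 * w 1) + X * (X * serD dz s ^ 2
      + 2 * serD dz (serD dz s) * (1 - X * s) + 4 * s ^ 2
      + 4 * C (w 1) * (-2 * s + X * s ^ 2))) := by
    have hX := serD_X_pow_mul dz 1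
    simp only [pow_one] at hX
    rw [epsSeries, serD_polySeries, serD_polySeries (fun i => dz (w i)),
      serD_polySeries, hs, hX, hX]
    simp only [map_mul, map_ofNat]
    ring
  rw [e, coeff_succ_X_mul, map_add, coeff_zero_X_mul, coeff_zero_C, add_zero]

lemma T_add_two (μ : ℕ → ℂ) (k : ℕ) :
    T μ (k + 2) = (1 / 4 : ℂ) • coeff (k + 2) (epsSeries (T μ)) - MvPolynomial.C (μ (k + 2)) := by
  have h : coeff (k + 2) (epsSeries fun i => if _ : i < k + 2 then T μ i else 0) =
      coeff (k + 2) (epsSeries (T μ)) :=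
    coeff_epsSeries_congr (by omega) fun i hi => dif_pos hi
  rw [T, h]

lemma T_one (μ : ℕ → ℂ) : T μ 1 = MvPolynomial.X 0 := by rw [T]

/-- The generating series of the polynomials `T_k` satisfies the generating function relation. -/
theorem quadForm_T (μ : ℕ → ℂ) :
    quadForm dz (MvPolynomial.X 0) (gSeries (T μ)) =
      4 * PowerSeries.map (algebraMap ℂ DiffPoly) (muSeries μ) := by
  have e := epsSeries_eq (T μ)
  rw [T_one] at e
  have e' : quadForm dz (MvPolynomial.X 0) (gSeries (T μ)) =
      epsSeries (T μ) + C 4 * 1 - C 8 * polySeries (T μ) := by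
    rw [e, map_ofNat, map_ofNat]; ring
  have e4 : (4 : DiffPoly⟦X⟧) = C 4 := by rw [map_ofNat]
  rw [e', e4]
  have h4 : ∀ x : DiffPoly, 4 * (1 / 4 : ℂ) • x = x := fun x => by
    rw [mul_smul_comm, ← smul_mul_assoc, Algebra.smul_def, ← map_ofNat (algebraMap ℂ DiffPoly) 4,
      ← map_mul]
    norm_num
  have h8 : ∀ x : DiffPoly, 8 * (1 / 2 : ℂ) • x = 4 * x := fun x => by
    rw [mul_smul_comm, ← smul_mul_assoc, Algebra.smul_def, ← map_ofNat (algebraMap ℂ DiffPoly) 8,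
      ← map_mul, ← map_ofNat (algebraMap ℂ DiffPoly) 4]
    norm_num
  ext1 n
  rw [map_sub, map_add, coeff_C_mul, coeff_C_mul, coeff_C_mul, coeff_map]
  match n with
  | 0 =>
    rw [coeff_zero_epsSeries, polySeries, coeff_mk, if_pos rfl, muSeries, coeff_mk, if_pos rfl,
      RingHom.map_one, mul_zero, sub_zero, zero_add, coeff_zero_one]
  | 1 =>
    rw [coeff_one_epsSeries, T_one, polySeries, coeff_mk, muSeries, coeff_mk, if_neg one_ne_zero,
      if_neg one_ne_zero, if_pos rfl, map_zero, h8, T_one, coeff_one, if_neg one_ne_zero]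
    ring
  | n + 2 =>
    rw [polySeries, coeff_mk, muSeries, coeff_mk, if_neg (by omega), if_neg (by omega),
      if_neg (by omega), h8, coeff_one, if_neg (by omega), T_add_two, mul_sub, h4,
      MvPolynomial.algebraMap_eq]
    ring

/-- Rescaling the generating series by a constant series changes the parameters `μ`. -/
lemma gSeries_T_eq_mul {a μ : ℕ → ℂ} (h : muSeries a ^ 2 = muSeries μ) :
    gSeries (T μ) = PowerSeries.map (algebraMap ℂ DiffPoly) (muSeries a) * gSeries (T 0) := by
  have hc : serD dz (PowerSeries.map (algebraMap ℂ DiffPoly) (muSeries a)) = 0 := by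
    ext1 n
    rw [coeff_serD, coeff_map, Derivation.map_algebraMap, map_zero]
  refine quadForm_injective dz (MvPolynomial.X 0) (constantCoeff_gSeries _) ?_ ?_
  · rw [map_mul, constantCoeff_gSeries, mul_one, ← coeff_zero_eq_constantCoeff_apply, coeff_map]
    simp [muSeries]
  · rw [quadForm_mul_of_const dz _ hc, quadForm_T, quadForm_T, ← map_pow, h]
    have : muSeries 0 = 1 := by
      ext n
      simp [muSeries, coeff_one]
    rw [this, map_one]
    ring

lemma muSeries_sq_iff (a μ : ℕ → ℂ) : muSeries a ^ 2 = muSeries μ ↔ ∀ k, 1 ≤ k →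
    μ (k + 1) = 2 * a (k + 1) + ∑ i ∈ Finset.Icc 1 (k - 2), a (i + 1) * a (k - i) := by
  have key : ∀ m, coeff (m + 2) (muSeries a ^ 2) =
      2 * a (m + 2) + ∑ i ∈ Finset.Icc 1 (m + 1 - 2), a (i + 1) * a (m + 1 - i) := by
    intro m
    rw [pow_two, coeff_mul, Finset.Nat.sum_antidiagonal_eq_sum_range_succ_mk,
      Finset.sum_range_succ, Finset.sum_range_succ']
    simp only [muSeries, coeff_mk]
    have h0 : (if m + 2 - 0 = 0 then 1 else if m + 2 - 0 = 1 then 0 else a (m + 2 - 0))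
      = a (m + 2) := by simp
    rw [if_neg (by omega : ¬ m + 2 = 0), if_neg (by omega : ¬ m + 2 = 1), h0, if_pos True.intro,
      Nat.sub_self, if_pos rfl]
    rw [Finset.sum_range_succ']
    have hs : ∑ i ∈ Finset.range m, (if i + 1 + 1 = 0 then (1 : ℂ) else
          if i + 1 + 1 = 1 then 0 else a (i + 1 + 1)) *
        (if m + 2 - (i + 1 + 1) = 0 then 1 else
          if m + 2 - (i + 1 + 1) = 1 then 0 else a (m + 2 - (i + 1 + 1))) =
        ∑ i ∈ Finset.Icc 1 (m + 1 - 2), a (i + 1) * a (m + 1 - i) := by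
      have hI : Finset.Icc 1 (m + 1 - 2) = Finset.Ico 1 (m - 1 + 1) := by
        ext x; simp only [Finset.mem_Icc, Finset.mem_Ico]; omega
      rw [hI, Finset.sum_Ico_eq_sum_range, Nat.add_sub_cancel]
      -- The last summand is paired with the coefficient of `ξ¹`, which is zero; for `m = 0` there
      -- is no such summand and truncated subtraction makes both ranges empty.
      have hlast : ∀ f : ℕ → ℂ, (1 ≤ m → f (m - 1) = 0) →
          ∑ i ∈ Finset.range m, f i = ∑ i ∈ Finset.range (m - 1), f i := by
        intro f hf
        cases m with
        | zero => rfl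
        | succ m => rw [Finset.sum_range_succ]; simpa using hf
      rw [hlast]
      · refine Finset.sum_congr rfl fun i hi => ?_
        rw [Finset.mem_range] at hi
        rw [if_neg (by omega), if_neg (by omega), if_neg (by omega), if_neg (by omega)]
        congr 2 <;> omega
      · intro hm
        rw [if_neg (by omega : ¬ m + 2 - (m - 1 + 1 + 1) = 0),
          if_pos (by omega : m + 2 - (m - 1 + 1 + 1) = 1), mul_zero]
    rw [hs]
    simp
    ring
  constructor
  · intro h k hk
    obtain ⟨m, rfl⟩ := Nat.exists_eq_add_of_le' hk
    rw [← key, h]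
    simp [muSeries]
  · intro h
    ext n
    match n with
    | 0 => simp [muSeries]
    | 1 =>
      rw [pow_two, coeff_mul, Finset.Nat.sum_antidiagonal_eq_sum_range_succ_mk]
      simp [Finset.sum_range_succ, muSeries]
    | m + 2 =>
      rw [key, ← h (m + 1) (by omega)]
      simp [muSeries]

/-- The constants `a` with `(1 + ∑ a_i ξ^i)² = 1 + ∑ μ_i ξ^i` exist for every `μ`. -/
lemma exists_muSeries_sq (μ : ℕ → ℂ) : ∃ a, muSeries a ^ 2 = muSeries μ := by
  -- In the square the top coefficient `a_n` enters only through `2 a_n`, so it can be solved for.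
  -- The guards serve the recursion alone: every index in the given range satisfies them.
  let a : ℕ → ℂ := fun n => n.strongRec fun n f =>
    (1 / 2) * (μ n - ∑ i ∈ (Finset.Icc 1 (n - 3)).attach,
      (if h : i.1 + 1 < n then f (i.1 + 1) h else 0) *
      (if h : n - 1 - i.1 < n then f (n - 1 - i.1) h else 0))
  refine ⟨a, (muSeries_sq_iff a μ).mpr fun k hk => ?_⟩
  have ha : a (k + 1) = (1 / 2) * (μ (k + 1) -
      ∑ i ∈ Finset.Icc 1 (k - 2), a (i + 1) * a (k - i)) := by
    have : a (k + 1) = (1 / 2) * (μ (k + 1) - ∑ i ∈ (Finset.Icc 1 (k + 1 - 3)).attach,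
      (if h : i.1 + 1 < k + 1 then a (i.1 + 1) else 0) *
      (if h : k + 1 - 1 - i.1 < k + 1 then a (k + 1 - 1 - i.1) else 0)) := by
      conv_lhs => simp only [a]
      rw [Nat.strongRec_eq]
    rw [this, ← Finset.sum_attach (Finset.Icc 1 (k - 2))]
    congr 2
    have : k + 1 - 3 = k - 2 := by omega
    rw [this]
    refine Finset.sum_congr rfl fun i _ => ?_
    have := Finset.mem_Icc.mp i.2
    rw [dif_pos (by omega), dif_pos (by omega), Nat.add_sub_cancel]
  rw [ha]; ring

end Recursion

/-! ### Homogeneity of the `T_k` for vanishing parameters -/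

section Weights

lemma HasWeight.smul {p : DiffPoly} {n : ℕ} (hp : HasWeight p n) (c : ℂ) : HasWeight (c • p) n :=
  (MvPolynomial.weightedHomogeneousSubmodule ℂ _ n).smul_mem c hp

lemma HasWeight.dz {p : DiffPoly} {n : ℕ} (hp : HasWeight p n) : HasWeight (dz p) (n + 1) := by
  induction hp using MvPolynomial.IsWeightedHomogeneous.induction_on with
  | zero => rw [map_zero]; exact MvPolynomial.isWeightedHomogeneous_zero _ _ _
  | add p q hp hq h1 h2 => rw [map_add]; exact h1.add h2
  | monomial s r hr =>
    rw [KdV.dz, MvPolynomial.mkDerivation_monomial, Finsupp.sum]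
    refine HasWeight.smul ?_ r
    refine MvPolynomial.IsWeightedHomogeneous.sum _ _ _ fun i hi => ?_
    have hi' : 1 ≤ s i := Nat.one_le_iff_ne_zero.mpr (Finsupp.mem_support_iff.mp hi)
    have hs : s = (s - Finsupp.single i 1) + Finsupp.single i 1 :=
      (tsub_add_cancel_of_le (Finsupp.single_le_iff.mpr hi')).symm
    have hw : Finsupp.weight (fun j : ℕ => j + 2) s =
        Finsupp.weight (fun j : ℕ => j + 2) (s - Finsupp.single i 1) + (i + 2) := by
      conv_lhs => rw [hs]
      rw [map_add, Finsupp.weight_single]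
      simp
    have hn : n + 1 = Finsupp.weight (fun j : ℕ => j + 2) (s - Finsupp.single i 1) +
        (i + 1 + 2) := by
      rw [← hr, hw]; ring
    rw [hn, smul_eq_mul]
    exact (MvPolynomial.isWeightedHomogeneous_monomial _ _ _ rfl).mul
      (MvPolynomial.isWeightedHomogeneous_X _ _ (i + 1))

lemma HasWeight.dz_iterate {p : DiffPoly} {n : ℕ} (hp : HasWeight p n) (i : ℕ) :
    HasWeight (KdV.dz^[i] p) (n + i) := by
  induction i with
  | zero => exact hp
  | succ i ih => rw [Function.iterate_succ_apply']; exact ih.dz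

/-- The coefficient of `ξ^n` is homogeneous of weight `2n + e`. -/
def SeriesWeight (f : DiffPoly⟦X⟧) (e : ℕ) : Prop := ∀ n, HasWeight (coeff n f) (2 * n + e)

lemma SeriesWeight.mul {f g : DiffPoly⟦X⟧} {a b : ℕ} (hf : SeriesWeight f a)
    (hg : SeriesWeight g b) : SeriesWeight (f * g) (a + b) := by
  intro n
  rw [coeff_mul]
  refine MvPolynomial.IsWeightedHomogeneous.sum _ _ _ fun p hp => ?_
  have h := (hf p.1).mul (hg p.2)
  have := Finset.HasAntidiagonal.mem_antidiagonal.mp hp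
  convert h using 1
  omega

lemma SeriesWeight.add {f g : DiffPoly⟦X⟧} {a : ℕ} (hf : SeriesWeight f a)
    (hg : SeriesWeight g a) : SeriesWeight (f + g) a := fun n => by
  rw [map_add]; exact (hf n).add (hg n)

lemma SeriesWeight.sub {f g : DiffPoly⟦X⟧} {a : ℕ} (hf : SeriesWeight f a)
    (hg : SeriesWeight g a) : SeriesWeight (f - g) a := fun n => by
  rw [map_sub]; exact (hf n).sub (hg n)

lemma SeriesWeight.X_mul {f : DiffPoly⟦X⟧} {a : ℕ} (hf : SeriesWeight f (a + 2)) :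
    SeriesWeight (X * f) a := by
  intro n
  cases n with
  | zero => rw [coeff_zero_X_mul]; exact MvPolynomial.isWeightedHomogeneous_zero _ _ _
  | succ n =>
    rw [coeff_succ_X_mul]
    convert hf n using 1
    ring

lemma seriesWeight_C {p : DiffPoly} {a : ℕ} (hp : HasWeight p a) :
    SeriesWeight (C p) a := by
  intro n
  rw [coeff_C]
  split_ifs with h
  · subst h; simpa using hp
  · exact MvPolynomial.isWeightedHomogeneous_zero _ _ _

lemma hasWeight_C (c : ℂ) : HasWeight (MvPolynomial.C c) 0 :=
  MvPolynomial.isWeightedHomogeneous_C _ c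

lemma seriesWeight_ofNat (n : ℕ) [n.AtLeastTwo] : SeriesWeight (OfNat.ofNat n) 0 := by
  have := seriesWeight_C (hasWeight_C (OfNat.ofNat n))
  rwa [map_ofNat, map_ofNat] at this

lemma seriesWeight_one : SeriesWeight 1 0 := by
  have := seriesWeight_C (hasWeight_C 1)
  rwa [MvPolynomial.C_1, map_one] at this

lemma seriesWeight_polySeries {w : ℕ → DiffPoly} {e : ℕ} (h : ∀ i, 1 ≤ i →
    HasWeight (w i) (2 * i + e)) : SeriesWeight (polySeries w) e := by
  intro n
  rw [polySeries, coeff_mk]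
  split_ifs with hn
  · exact MvPolynomial.isWeightedHomogeneous_zero _ _ _
  · exact (h n (Nat.one_le_iff_ne_zero.mpr hn)).smul _

lemma hasWeight_X (i : ℕ) : HasWeight (MvPolynomial.X i) (i + 2) :=
  MvPolynomial.isWeightedHomogeneous_X _ _ i

lemma seriesWeight_epsSeries {w : ℕ → DiffPoly} (h : ∀ i, 1 ≤ i → HasWeight (w i) (2 * i)) :
    SeriesWeight (epsSeries w) 0 := by
  have h1 : SeriesWeight (polySeries w) 0 := seriesWeight_polySeries h
  have h2 : SeriesWeight (polySeries fun i => dz (w i)) 1 :=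
    seriesWeight_polySeries fun i hi => (h i hi).dz
  have h3 : SeriesWeight (polySeries fun i => dz (dz (w i))) 2 :=
    seriesWeight_polySeries fun i hi => (h i hi).dz.dz
  have h4 : SeriesWeight (C (w 1)) 2 := seriesWeight_C (h 1 le_rfl)
  have h5 := seriesWeight_one.sub h1
  have e : epsSeries w = X * (polySeries fun i => dz (w i)) ^ 2
      + X * (2 * (polySeries fun i => dz (dz (w i))) * (1 - polySeries w))
      + 4 * (polySeries w * polySeries w)
      + X * (4 * C (w 1) * ((1 - polySeries w) * (1 - polySeries w))) := by
    rw [epsSeries]; ring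
  rw [e, pow_two]
  exact (((h2.mul h2).X_mul.add (((seriesWeight_ofNat 2).mul h3).mul h5).X_mul).add
    ((seriesWeight_ofNat 4).mul (h1.mul h1))).add
    (((seriesWeight_ofNat 4).mul h4).mul (h5.mul h5)).X_mul

/-- With vanishing parameters, `T_k` is homogeneous of weight `2k`. -/
lemma hasWeight_T_zero (k : ℕ) : HasWeight (T 0 k) (2 * k) := by
  induction k using Nat.strongRec with
  | ind k ih =>
    match k with
    | 0 => rw [T]; exact MvPolynomial.isWeightedHomogeneous_zero _ _ _
    | 1 => rw [T_one]; exact hasWeight_X 0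
    | k + 2 =>
      rw [T, Pi.zero_apply, map_zero, sub_zero]
      refine HasWeight.smul (seriesWeight_epsSeries (fun i _ => ?_) (k + 2)) _
      split_ifs with hi
      · exact ih i hi
      · exact MvPolynomial.isWeightedHomogeneous_zero _ _ _

end Weights

/-! ### The kernel of `∂_z` on differential polynomials -/

section Kernel

/-- The commutator of `∂/∂u^{(m+1)}` with `∂_z` is `∂/∂u^{(m)}`, because `∂_z` sends `u^{(m)}` to
`u^{(m+1)}`. -/
lemma pderiv_succ_dz (m : ℕ) (p : DiffPoly) :
    MvPolynomial.pderiv (m + 1) (dz p) = dz (MvPolynomial.pderiv (m + 1) p) +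
      MvPolynomial.pderiv m p := by
  induction p using MvPolynomial.induction_on with
  | C a => simp [dz]
  | add p q hp hq => simp only [map_add, hp, hq]; ring
  | mul_X p i hp =>
    simp only [Derivation.leibniz, map_add, hp, smul_eq_mul]
    have h1 : dz (MvPolynomial.X i) = MvPolynomial.X (i + 1) :=
      MvPolynomial.mkDerivation_X ℂ _ i
    rw [h1]
    simp only [MvPolynomial.pderiv_X, Pi.single_apply, Nat.add_right_cancel_iff]
    have h2 : ∀ c : Prop, [Decidable c] → dz (if c then (1 : DiffPoly) else 0) = 0 := by
      intro c _; split_ifs <;> simp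
    rw [h2]
    ring

lemma exists_pderiv_eq_zero (p : DiffPoly) : ∃ N, ∀ n ≥ N, MvPolynomial.pderiv n p = 0 := by
  refine ⟨p.vars.sup id + 1, fun n hn => MvPolynomial.pderiv_eq_zero_of_notMem_vars fun h => ?_⟩
  have := Finset.le_sup (f := id) h
  simp only [id] at this
  omega

/-- The kernel of `∂_z` contains no nonzero homogeneous polynomial of positive weight. -/
lemma eq_zero_of_dz_eq_zero {p : DiffPoly} {n : ℕ} (hn : n ≠ 0) (hp : HasWeight p n)
    (h : dz p = 0) : p = 0 := by
  obtain ⟨N, hN⟩ := exists_pderiv_eq_zero p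
  -- Descent in `m`: if `∂_z p = 0` and `p` is free of `u^{(m+1)}`, the commutator shows that it is
  -- free of `u^{(m)}`. So `p` is a constant, excluded by its weight unless zero.
  have key : ∀ j, ∀ m, N ≤ m + j → MvPolynomial.pderiv m p = 0 := by
    intro j
    induction j with
    | zero => intro m hm; exact hN m hm
    | succ j ih =>
      intro m hm
      have := pderiv_succ_dz m p
      rw [h, ih (m + 1) (by omega)] at this
      simpa using this.symm
  ext s
  rw [MvPolynomial.coeff_zero]
  by_contra hs
  have hw := hp hs
  have : s ≠ 0 := by
    rintro rfl
    rw [map_zero] at hw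
    exact hn hw.symm
  obtain ⟨i, hi⟩ := Finsupp.ne_iff.mp this
  have hi' : 1 ≤ s i := Nat.one_le_iff_ne_zero.mpr hi
  have hc := MvPolynomial.coeff_pderiv (i := i) p (s - Finsupp.single i 1)
  rw [key N i (by omega), tsub_add_cancel_of_le (Finsupp.single_le_iff.mpr hi'),
    MvPolynomial.coeff_zero] at hc
  rcases mul_eq_zero.mp hc.symm with h0 | h0
  · exact hs h0
  · exact Nat.cast_add_one_ne_zero _ h0

end Kernel

/-! ### Leibniz formulas for powers of a derivation -/

section Leibniz

variable {A : Type*} [Ring A] [Algebra ℂ A]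

/-- Left multiplication by `x` is the sum of `ad x` and right multiplication, which commute, so the
binomial theorem applies; `ad x` acts on the `p i` as a shift. -/
lemma pow_mul_eq_sum_of_derivation {x : A} {p : ℕ → A} (h : ∀ i, x * p i = p i * x + p (i + 1))
    (n : ℕ) : x ^ n * p 0 =
      ∑ i ∈ Finset.range (n + 1), (n.choose i : ℂ) • (p i * x ^ (n - i)) := by
  set l := LinearMap.mulLeft ℂ x with hl
  set r := LinearMap.mulRight ℂ x with hr
  have hc : Commute (l - r) r :=
    Commute.sub_left (LinearMap.commute_mulLeft_right _ _) (Commute.refl _)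
  have had : ∀ i, ((l - r) ^ i) (p 0) = p i := by
    intro i
    induction i with
    | zero => rfl
    | succ i ih =>
      rw [pow_succ', Module.End.mul_apply, ih, LinearMap.sub_apply, hl, hr,
        LinearMap.mulLeft_apply, LinearMap.mulRight_apply, h]
      abel
  have h1 := hc.add_pow n
  rw [sub_add_cancel, hl, LinearMap.pow_mulLeft, ← hl] at h1
  have h2 := LinearMap.congr_fun h1 (p 0)
  rw [LinearMap.sum_apply] at h2
  refine h2.trans (Finset.sum_congr rfl fun i _ => ?_)
  rw [(hc.pow_pow i (n - i)).eq, ← Nat.cast_comm, ← nsmul_eq_mul,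
    LinearMap.smul_apply, Module.End.mul_apply, had, hr, LinearMap.pow_mulRight,
    LinearMap.mulRight_apply, Nat.cast_smul_eq_nsmul]

lemma mul_pow_eq_sum_of_derivation {x : A} {p : ℕ → A} (h : ∀ i, x * p i = p i * x + p (i + 1))
    (n : ℕ) : p 0 * x ^ n =
      ∑ i ∈ Finset.range (n + 1), ((-1) ^ i * n.choose i : ℂ) • (x ^ (n - i) * p i) := by
  set l := LinearMap.mulLeft ℂ x with hl
  set r := LinearMap.mulRight ℂ x with hr
  have hc : Commute (r - l) l :=
    Commute.sub_left (LinearMap.commute_mulLeft_right _ _).symm (Commute.refl _)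
  have had : ∀ i, ((r - l) ^ i) (p 0) = ((-1) ^ i : ℂ) • p i := by
    intro i
    induction i with
    | zero => simp
    | succ i ih =>
      rw [pow_succ', Module.End.mul_apply, ih, map_smul, LinearMap.sub_apply, hl, hr,
        LinearMap.mulLeft_apply, LinearMap.mulRight_apply, h, pow_succ]
      module
  have h1 := hc.add_pow n
  rw [sub_add_cancel, hr, LinearMap.pow_mulRight, ← hr] at h1
  have h2 := LinearMap.congr_fun h1 (p 0)
  rw [LinearMap.sum_apply] at h2
  refine h2.trans (Finset.sum_congr rfl fun i _ => ?_)
  rw [(hc.pow_pow i (n - i)).eq, ← Nat.cast_comm, ← nsmul_eq_mul,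
    LinearMap.smul_apply, Module.End.mul_apply, had, hl, LinearMap.pow_mulLeft,
    LinearMap.mulLeft_apply, ← Nat.cast_smul_eq_nsmul ℂ, mul_smul_comm, smul_smul, mul_comm]

end Leibniz

/-! ### Symmetric form and commutators of the candidates for `A_{2k+1}` -/

section SymmetricOperators

variable {A : Type*} [Ring A] [Algebra ℂ A] {x : A} {M : DiffPoly →ₐ[ℂ] A}

/-- The operator `α ∂^n - (-1)^n ∂^n α`. -/
def skewOp (x : A) (M : DiffPoly →ₐ[ℂ] A) (n : ℕ) (p : DiffPoly) : A :=
  M p * x ^ n - ((-1) ^ n : ℂ) • (x ^ n * M p)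

lemma skewOp_of_odd {n : ℕ} (hn : Odd n) (p : DiffPoly) :
    skewOp x M n p = M p * x ^ n + x ^ n * M p := by
  rw [skewOp, hn.neg_one_pow, neg_one_smul, sub_neg_eq_add]

/-- Moving `q` to the left of `∂^n` in the first product and to the right in the second gives two
Leibniz sums whose terms pair up into skew operators. -/
lemma skewOp_sandwich (hx : ∀ p, x * M p = M p * x + M (dz p)) (n : ℕ) (p q : DiffPoly) :
    M p * x ^ n * M q - ((-1) ^ n : ℂ) • (M q * x ^ n * M p) =
      ∑ i ∈ Finset.range (n + 1), (n.choose i : ℂ) • skewOp x M (n - i) (p * dz^[i] q) := by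
  have h : ∀ i, x * M (dz^[i] q) = M (dz^[i] q) * x + M (dz^[i + 1] q) := fun i => by
    rw [Function.iterate_succ_apply', hx]
  have h1 := pow_mul_eq_sum_of_derivation h n
  have h2 := mul_pow_eq_sum_of_derivation h n
  simp only [Function.iterate_zero, id] at h1 h2
  rw [mul_assoc (M p), h1, h2, Finset.mul_sum,
    Finset.sum_mul, Finset.smul_sum, ← Finset.sum_sub_distrib]
  refine Finset.sum_congr rfl fun i hi => ?_
  have hi' : i ≤ n := by rw [Finset.mem_range] at hi; omega
  have hs : ((-1) ^ (n - i) : ℂ) = (-1) ^ n * (-1) ^ i := by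
    obtain ⟨j, rfl⟩ := Nat.exists_eq_add_of_le hi'
    rw [Nat.add_sub_cancel_left, pow_add, mul_right_comm, ← mul_pow]
    norm_num
  have hc : M (dz^[i] q) * M p = M p * M (dz^[i] q) := by rw [← map_mul, mul_comm, map_mul]
  rw [skewOp, hs, map_mul, mul_smul_comm, smul_mul_assoc, mul_assoc (M p),
    mul_assoc (x ^ (n - i)), hc]
  module

/-- This is the sandwich identity with 1 as one factor. For even `n` it expresses the skew operator
of order `n` by those of lower order. -/
lemma skewOp_sum (hx : ∀ p, x * M p = M p * x + M (dz p)) (n : ℕ) (p : DiffPoly) :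
    ∑ i ∈ Finset.range (n + 1), (n.choose i : ℂ) • skewOp x M (n - i) (dz^[i] p) =
      -((-1) ^ n : ℂ) • skewOp x M n p := by
  have h := skewOp_sandwich hx n 1 p
  simp only [one_mul, map_one, mul_one] at h
  rw [← h, skewOp, smul_sub, smul_smul, neg_mul, ← mul_pow]
  norm_num
  abel

/-- The operators `∑_{j=1}^k (α_{2j} ∂^{2k-2j+1} + ∂^{2k-2j+1} α_{2j})` with `α_{2j}` homogeneous of
weight `2j`. -/
def SymForm (x : A) (M : DiffPoly →ₐ[ℂ] A) (k : ℕ) (B : A) : Prop :=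
  ∃ α : ℕ → DiffPoly, (∀ j ∈ Finset.Icc 1 k, HasWeight (α j) (2 * j)) ∧
    B = ∑ j ∈ Finset.Icc 1 k,
      (M (α j) * x ^ (2 * k - 2 * j + 1) + x ^ (2 * k - 2 * j + 1) * M (α j))

lemma SymForm.add {k : ℕ} {B B' : A} (hB : SymForm x M k B) (hB' : SymForm x M k B') :
    SymForm x M k (B + B') := by
  obtain ⟨α, hα, rfl⟩ := hB
  obtain ⟨β, hβ, rfl⟩ := hB'
  refine ⟨fun j => α j + β j, fun j hj => (hα j hj).add (hβ j hj), ?_⟩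
  rw [← Finset.sum_add_distrib]
  refine Finset.sum_congr rfl fun j _ => ?_
  rw [map_add, add_mul, mul_add]
  abel

lemma SymForm.smul {k : ℕ} {B : A} (hB : SymForm x M k B) (c : ℂ) :
    SymForm x M k (c • B) := by
  obtain ⟨α, hα, rfl⟩ := hB
  refine ⟨fun j => c • α j, fun j hj => (hα j hj).smul c, ?_⟩
  rw [Finset.smul_sum]
  refine Finset.sum_congr rfl fun j _ => ?_
  rw [map_smul, smul_mul_assoc, mul_smul_comm, smul_add]

lemma symForm_zero (k : ℕ) : SymForm x M k 0 :=
  ⟨0, fun _ _ => MvPolynomial.isWeightedHomogeneous_zero _ _ _, by simp⟩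

lemma SymForm.sum {k : ℕ} {ι : Type*} (s : Finset ι) {B : ι → A}
    (h : ∀ i ∈ s, SymForm x M k (B i)) : SymForm x M k (∑ i ∈ s, B i) := by
  classical
  induction s using Finset.induction_on with
  | empty => exact symForm_zero k
  | insert a s ha ih =>
    rw [Finset.sum_insert ha]
    exact (h a (Finset.mem_insert_self _ _)).add
      (ih fun i hi => h i (Finset.mem_insert_of_mem hi))

lemma symForm_single {k j : ℕ} (hj : j ∈ Finset.Icc 1 k) {p : DiffPoly}
    (hp : HasWeight p (2 * j)) :
    SymForm x M k (M p * x ^ (2 * k - 2 * j + 1) + x ^ (2 * k - 2 * j + 1) * M p) := by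
  refine ⟨fun i => if i = j then p else 0, fun i _ => ?_, ?_⟩
  · dsimp only
    split_ifs with h
    · rw [h]; exact hp
    · exact MvPolynomial.isWeightedHomogeneous_zero _ _ _
  · rw [Finset.sum_eq_single_of_mem j hj]
    · simp
    · intro i _ hi
      simp [hi]

/-- Odd orders are already of the required shape. Even orders are reduced by `skewOp_sum`, each
lowering of the order being matched by a derivative of the coefficient, so that `b + n` is
preserved. -/
lemma symForm_skewOp (hx : ∀ p, x * M p = M p * x + M (dz p)) {k : ℕ} (n : ℕ) :
    ∀ {b : ℕ} {p : DiffPoly}, 1 ≤ b → b + n = 2 * k + 1 →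
    HasWeight p b → SymForm x M k (skewOp x M n p) := by
  induction n using Nat.strongRec with
  | ind n ih =>
    intro b p hb hbn hp
    rcases Nat.even_or_odd n with he | ho
    · have hsum := skewOp_sum hx n p
      rw [Finset.sum_range_succ', he.neg_one_pow] at hsum
      simp only [Nat.choose_zero_right, Nat.cast_one, one_smul, Nat.sub_zero,
        Function.iterate_zero, id] at hsum
      have h2 : skewOp x M n p = (-(1 / 2) : ℂ) • ∑ i ∈ Finset.range n,
          (n.choose (i + 1) : ℂ) • skewOp x M (n - (i + 1)) (dz^[i + 1] p) := by
        rw [eq_sub_of_add_eq hsum]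
        module
      rw [h2]
      refine SymForm.smul (SymForm.sum _ fun i hi => SymForm.smul ?_ _) _
      rw [Finset.mem_range] at hi
      exact ih (n - (i + 1)) (by omega) (b := b + (i + 1)) (by omega) (by omega)
        (hp.dz_iterate (i + 1))
    · obtain ⟨m, hm⟩ := id ho
      obtain ⟨j, rfl⟩ : ∃ j, b = 2 * j := ⟨k - m, by omega⟩
      have hj : j ∈ Finset.Icc 1 k := Finset.mem_Icc.mpr (by omega)
      have := symForm_single (x := x) (M := M) hj hp
      have e : 2 * k - 2 * j + 1 = n := by omega
      rwa [e, ← skewOp_of_odd ho] at this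

lemma sq_mul_eq (hx : ∀ p, x * M p = M p * x + M (dz p)) (p : DiffPoly) :
    x ^ 2 * M p = M p * x ^ 2 + (2 : ℂ) • (M (dz p) * x) + M (dz (dz p)) := by
  rw [pow_two, mul_assoc, hx, mul_add, ← mul_assoc, hx, hx, two_smul]
  noncomm_ring

lemma mul_sq_eq (hx : ∀ p, x * M p = M p * x + M (dz p)) (p : DiffPoly) :
    M p * x ^ 2 = x ^ 2 * M p - (2 : ℂ) • (x * M (dz p)) + M (dz (dz p)) := by
  rw [sq_mul_eq hx, hx (dz p)]
  module

lemma skewOp_anticomm_sq (hx : ∀ p, x * M p = M p * x + M (dz p)) (n : ℕ) (p : DiffPoly) :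
    skewOp x M n p * x ^ 2 + x ^ 2 * skewOp x M n p = (2 : ℂ) • skewOp x M (n + 2) p
      + (2 : ℂ) • skewOp x M (n + 1) (dz p) + skewOp x M n (dz (dz p)) := by
  have e1 : x ^ 2 * (M p * x ^ n) = M p * x ^ (n + 2) + (2 : ℂ) • (M (dz p) * x ^ (n + 1))
      + M (dz (dz p)) * x ^ n := by
    rw [← mul_assoc, sq_mul_eq hx, add_mul, add_mul, smul_mul_assoc, mul_assoc, mul_assoc,
      ← pow_add, ← pow_succ', add_comm 2 n]
  have e2 : x ^ n * M p * x ^ 2 = x ^ (n + 2) * M p - (2 : ℂ) • (x ^ (n + 1) * M (dz p))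
      + x ^ n * M (dz (dz p)) := by
    rw [mul_assoc, mul_sq_eq hx, mul_add, mul_sub, mul_smul_comm, ← mul_assoc, ← mul_assoc,
      ← pow_add, ← pow_succ]
  have e3 : M p * x ^ n * x ^ 2 = M p * x ^ (n + 2) := by rw [mul_assoc, ← pow_add]
  have e4 : x ^ 2 * (x ^ n * M p) = x ^ (n + 2) * M p := by
    rw [← mul_assoc, ← pow_add, add_comm 2 n]
  simp only [skewOp, sub_mul, mul_sub, smul_mul_assoc, mul_smul_comm]
  rw [e1, e2, e3, e4, pow_succ (-1 : ℂ) (n + 1), pow_succ (-1 : ℂ) n]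
  module

lemma skewOp_anticomm_mul (hx : ∀ p, x * M p = M p * x + M (dz p)) {n : ℕ} (hn : Odd n)
    (p q : DiffPoly) :
    skewOp x M n p * M q + M q * skewOp x M n p = skewOp x M n (p * q) +
      ∑ i ∈ Finset.range (n + 1), (n.choose i : ℂ) • skewOp x M (n - i) (p * dz^[i] q) := by
  have hc : M q * M p = M p * M q := by rw [← map_mul, mul_comm, map_mul]
  rw [← skewOp_sandwich hx, skewOp_of_odd hn, skewOp_of_odd hn, hn.neg_one_pow, neg_one_smul,
    map_mul]
  have h1 : M q * (M p * x ^ n + x ^ n * M p) = M p * M q * x ^ n + M q * x ^ n * M p := by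
    rw [← hc]; noncomm_ring
  rw [h1]
  noncomm_ring

/-- Skew operators are stable under the symmetrised product with `L = ∂² - u`. -/
lemma SymForm.anticomm (hx : ∀ p, x * M p = M p * x + M (dz p)) {k : ℕ} {B : A}
    (hB : SymForm x M k B) :
    SymForm x M (k + 1) (B * (x ^ 2 - M (MvPolynomial.X 0)) +
      (x ^ 2 - M (MvPolynomial.X 0)) * B) := by
  obtain ⟨α, hα, rfl⟩ := hB
  rw [Finset.sum_mul, Finset.mul_sum, ← Finset.sum_add_distrib]
  refine SymForm.sum _ fun j hj => ?_
  have hodd : Odd (2 * k - 2 * j + 1) := ⟨k - j, by omega⟩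
  have hw := hα j hj
  rw [Finset.mem_Icc] at hj
  rw [← skewOp_of_odd hodd]
  set n := 2 * k - 2 * j + 1 with hn
  have e : skewOp x M n (α j) * (x ^ 2 - M (MvPolynomial.X 0)) +
      (x ^ 2 - M (MvPolynomial.X 0)) * skewOp x M n (α j) =
      (skewOp x M n (α j) * x ^ 2 + x ^ 2 * skewOp x M n (α j)) +
        (-1 : ℂ) • (skewOp x M n (α j) * M (MvPolynomial.X 0) +
          M (MvPolynomial.X 0) * skewOp x M n (α j)) := by
    rw [neg_one_smul]; noncomm_ring
  rw [e, skewOp_anticomm_sq hx, skewOp_anticomm_mul hx hodd]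
  refine SymForm.add (SymForm.add (SymForm.add ?_ ?_) ?_) (SymForm.smul (SymForm.add ?_ ?_) _)
  · exact (symForm_skewOp hx _ (b := 2 * j) (by omega) (by omega) hw).smul _
  · exact (symForm_skewOp hx _ (b := 2 * j + 1) (by omega) (by omega) hw.dz).smul _
  · exact symForm_skewOp hx _ (b := 2 * j + 1 + 1) (by omega) (by omega) hw.dz.dz
  · exact symForm_skewOp hx _ (b := 2 * j + (0 + 2)) (by omega) (by omega) (hw.mul (hasWeight_X 0))
  · refine SymForm.sum _ fun i hi => SymForm.smul ?_ _
    rw [Finset.mem_range] at hi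
    exact symForm_skewOp hx _ (b := 2 * j + (0 + 2 + i)) (by omega) (by omega)
      (hw.mul ((hasWeight_X 0).dz_iterate i))

/-- The operators `A_{2k+1} = ∑_{i=0}^k (g_i ∂ - ½ g_i') L^{k-i}`. -/
def laxOp (x : A) (M : DiffPoly →ₐ[ℂ] A) (g : ℕ → DiffPoly) : ℕ → A
  | 0 => x
  | k + 1 => laxOp x M g k * (x ^ 2 - M (MvPolynomial.X 0)) + M (g (k + 1)) * x
      - (1 / 2 : ℂ) • M (dz (g (k + 1)))

/-- In the inductive step the differential parts of `[L, A]L` and `[L, f∂ - ½f']` cancel, leaving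
`2uf' + u'f - ½f'''`, which the Lenard recursion identifies as `-2 g_{k+2}'`. -/
lemma comm_laxOp (hx : ∀ p, x * M p = M p * x + M (dz p)) {g : ℕ → DiffPoly}
    (hg1 : (2 : ℂ) • g 1 = -MvPolynomial.X 0)
    (hg : ∀ k, 1 ≤ k → (4 : ℂ) • dz (g (k + 1)) = dz (dz (dz (g k)))
      - (4 : ℂ) • (MvPolynomial.X 0 * dz (g k)) - (2 : ℂ) • (dz (MvPolynomial.X 0) * g k)) (k : ℕ) :
    (x ^ 2 - M (MvPolynomial.X 0)) * laxOp x M g k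
      - laxOp x M g k * (x ^ 2 - M (MvPolynomial.X 0)) = (-2 : ℂ) • M (dz (g (k + 1))) := by
  set u : DiffPoly := MvPolynomial.X 0 with hu
  induction k with
  | zero =>
    have h1 : (2 : ℂ) • dz (g 1) = - dz u := by rw [← Derivation.map_smul, hg1, map_neg]
    have h2 := congrArg M h1
    rw [map_smul, map_neg] at h2
    rw [laxOp, zero_add, neg_smul, h2, neg_neg, mul_sub, sub_mul, hx, pow_two, mul_assoc]
    abel
  | succ k ih =>
    set L := x ^ 2 - M u with hL
    set f := g (k + 1) with hf
    have h3 := congrArg M (hg (k + 1) (Nat.le_add_left 1 k))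
    rw [← hf] at h3
    simp only [map_sub, map_smul, map_mul] at h3
    have e1 : L * (M f * x) - M f * x * L =
        (2 : ℂ) • (M (dz f) * x ^ 2) + M (dz (dz f)) * x + M f * M (dz u) := by
      have c : M u * M f = M f * M u := by rw [← map_mul, mul_comm, map_mul]
      have a1 : L * (M f * x) = (x ^ 2 * M f) * x - M f * M u * x := by
        rw [hL, ← c]; noncomm_ring
      have a2 : M f * x * L = M f * x ^ 2 * x - M f * (M u * x + M (dz u)) := by
        rw [hL, ← hx]; noncomm_ring
      rw [a1, a2, sq_mul_eq hx, add_mul, add_mul, smul_mul_assoc, mul_assoc (M (dz f)), ← pow_two,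
        mul_add, ← mul_assoc]
      abel
    have e2 : L * M (dz f) - M (dz f) * L =
        (2 : ℂ) • (M (dz (dz f)) * x) + M (dz (dz (dz f))) := by
      have c : M u * M (dz f) = M (dz f) * M u := by rw [← map_mul, mul_comm, map_mul]
      rw [hL, sub_mul, mul_sub, sq_mul_eq hx, c]
      abel
    have e3 : L * laxOp x M g (k + 1) - laxOp x M g (k + 1) * L =
        (L * laxOp x M g k - laxOp x M g k * L) * L + (L * (M f * x) - M f * x * L)
          - (1 / 2 : ℂ) • (L * M (dz f) - M (dz f) * L) := by
      have gen : ∀ a b c K : A, K * (a * K + b - (1 / 2 : ℂ) • c)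
          - (a * K + b - (1 / 2 : ℂ) • c) * K =
          (K * a - a * K) * K + (K * b - b * K) - (1 / 2 : ℂ) • (K * c - c * K) := by
        intro a b c K
        rw [mul_sub, sub_mul _ _ K, mul_smul_comm, smul_mul_assoc, smul_sub]
        noncomm_ring
      exact gen _ _ _ _
    have c1 : M f * M (dz u) = M (dz u) * M f := by rw [← map_mul, mul_comm, map_mul]
    have c2 : M (dz f) * M u = M u * M (dz f) := by rw [← map_mul, mul_comm, map_mul]
    have e4 : (-2 : ℂ) • M (dz (g (k + 1 + 1))) =
        (-(1 / 2) : ℂ) • ((4 : ℂ) • M (dz (g (k + 1 + 1)))) := by module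
    rw [e3, ih, e1, e2, e4, h3, c1, hL, smul_mul_assoc, mul_sub, c2]
    module

/-- The product `AL` is half the anticommutator, which preserves the symmetric form, plus `f'` by
`comm_laxOp`. The added `f∂ - ½f'` turns `f'` into `½(f∂ + ∂f)`. -/
lemma symForm_laxOp (hx : ∀ p, x * M p = M p * x + M (dz p)) {g : ℕ → DiffPoly}
    (hg1 : (2 : ℂ) • g 1 = -MvPolynomial.X 0)
    (hg : ∀ k, 1 ≤ k → (4 : ℂ) • dz (g (k + 1)) = dz (dz (dz (g k)))
      - (4 : ℂ) • (MvPolynomial.X 0 * dz (g k)) - (2 : ℂ) • (dz (MvPolynomial.X 0) * g k))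
    (hw : ∀ k, HasWeight (g k) (2 * k)) (k : ℕ) :
    SymForm x M k (laxOp x M g k - x ^ (2 * k + 1)) := by
  induction k with
  | zero =>
    rw [laxOp, mul_zero, zero_add, pow_one, sub_self]
    exact symForm_zero 0
  | succ k ih =>
    set L := x ^ 2 - M (MvPolynomial.X 0) with hL
    have hc := comm_laxOp hx hg1 hg k
    rw [← hL] at hc
    set f := g (k + 1) with hf
    have hodd : Odd (2 * k + 1) := ⟨k, rfl⟩
    have e0 : laxOp x M g k * L = (1 / 2 : ℂ) • (laxOp x M g k * L + L * laxOp x M g k)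
        + M (dz f) := by
      rw [eq_add_of_sub_eq hc]
      module
    have e1 : x ^ (2 * k + 1) * L + L * x ^ (2 * k + 1) = (2 : ℂ) • x ^ (2 * (k + 1) + 1)
        - skewOp x M (2 * k + 1) (MvPolynomial.X 0) := by
      have a : x ^ (2 * k + 1) * x ^ 2 = x ^ (2 * (k + 1) + 1) := by rw [← pow_add]; ring_nf
      have b : x ^ 2 * x ^ (2 * k + 1) = x ^ (2 * (k + 1) + 1) := by rw [← pow_add]; ring_nf
      rw [hL, mul_sub, sub_mul, a, b, skewOp_of_odd hodd, two_smul]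
      abel
    have e2 : skewOp x M 1 f = (2 : ℂ) • (M f * x) + M (dz f) := by
      rw [skewOp_of_odd odd_one, pow_one, hx, two_smul]; abel
    have e : laxOp x M g (k + 1) - x ^ (2 * (k + 1) + 1) =
        ((1 / 2 : ℂ) • ((laxOp x M g k - x ^ (2 * k + 1)) * L
          + L * (laxOp x M g k - x ^ (2 * k + 1)))
        + (-(1 / 2) : ℂ) • skewOp x M (2 * k + 1) (MvPolynomial.X 0))
        + (1 / 2 : ℂ) • skewOp x M 1 f := by
      have a : (laxOp x M g k - x ^ (2 * k + 1)) * L + L * (laxOp x M g k - x ^ (2 * k + 1)) =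
          (laxOp x M g k * L + L * laxOp x M g k)
            - (x ^ (2 * k + 1) * L + L * x ^ (2 * k + 1)) := by noncomm_ring
      conv_lhs => rw [laxOp, ← hL, ← hf, e0]
      rw [a, e1, e2]
      module
    rw [e]
    refine ((SymForm.smul (ih.anticomm hx) _).add (SymForm.smul ?_ _)).add (SymForm.smul ?_ _)
    · exact symForm_skewOp hx _ (b := 0 + 2) (by omega) (by omega) (hasWeight_X 0)
    · exact symForm_skewOp hx _ (b := 2 * (k + 1)) (by omega) (by omega) (hw (k + 1))

end SymmetricOperators

/-! ### Orders of differential operators and uniqueness of the symmetric form -/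

section Order

variable {A : Type*} [Ring A] [Algebra ℂ A] {x : A} {M : DiffPoly →ₐ[ℂ] A}

/-- The differential operators of order less than `n`. -/
def ordLT (x : A) (M : DiffPoly →ₐ[ℂ] A) (n : ℕ) : Submodule ℂ A :=
  Submodule.span ℂ {B | ∃ i < n, ∃ c, B = M c * x ^ i}

lemma mul_pow_mem_ordLT {i n : ℕ} (h : i < n) (c : DiffPoly) : M c * x ^ i ∈ ordLT x M n :=
  Submodule.subset_span ⟨i, h, c, rfl⟩

lemma ordLT_mono {m n : ℕ} (h : m ≤ n) : ordLT x M m ≤ ordLT x M n :=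
  Submodule.span_mono fun _ ⟨i, hi, c, hc⟩ => ⟨i, hi.trans_le h, c, hc⟩

lemma mul_mem_ordLT {n : ℕ} (c : DiffPoly) {B : A} (hB : B ∈ ordLT x M n) :
    M c * B ∈ ordLT x M n := by
  induction hB using Submodule.span_induction with
  | mem B hB =>
    obtain ⟨i, hi, d, rfl⟩ := hB
    rw [← mul_assoc, ← map_mul]
    exact mul_pow_mem_ordLT hi _
  | zero => rw [mul_zero]; exact Submodule.zero_mem _
  | add B B' _ _ h h' => rw [mul_add]; exact Submodule.add_mem _ h h'
  | smul a B _ h => rw [mul_smul_comm]; exact Submodule.smul_mem _ a h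

lemma pow_mul_sub_mem_ordLT (hx : ∀ p, x * M p = M p * x + M (dz p)) (n : ℕ) (p : DiffPoly) :
    x ^ n * M p - M p * x ^ n ∈ ordLT x M n := by
  have h : ∀ i, x * M (dz^[i] p) = M (dz^[i] p) * x + M (dz^[i + 1] p) := fun i => by
    rw [Function.iterate_succ_apply', hx]
  have h1 := pow_mul_eq_sum_of_derivation h n
  rw [Finset.sum_range_succ'] at h1
  simp only [Function.iterate_zero, id, Nat.choose_zero_right, Nat.cast_one, one_smul,
    Nat.sub_zero] at h1
  rw [h1, add_sub_cancel_right]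
  refine Submodule.sum_mem _ fun i hi => Submodule.smul_mem _ _ (mul_pow_mem_ordLT ?_ _)
  rw [Finset.mem_range] at hi
  omega

lemma comm_mul_pow_mem_ordLT (hx : ∀ p, x * M p = M p * x + M (dz p)) (u c : DiffPoly) (n : ℕ) :
    (x ^ 2 - M u) * (M c * x ^ n) - (M c * x ^ n) * (x ^ 2 - M u)
      - (2 : ℂ) • (M (dz c) * x ^ (n + 1)) ∈ ordLT x M (n + 1) := by
  have hc : M u * M c = M c * M u := by rw [← map_mul, mul_comm, map_mul]
  have h2 : x ^ 2 * x ^ n = x ^ n * x ^ 2 := by rw [← pow_add, ← pow_add, add_comm]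
  have e : (x ^ 2 - M u) * (M c * x ^ n) - (M c * x ^ n) * (x ^ 2 - M u)
      - (2 : ℂ) • (M (dz c) * x ^ (n + 1)) =
      M (dz (dz c)) * x ^ n + M c * (x ^ n * M u - M u * x ^ n) := by
    rw [sub_mul, ← mul_assoc, sq_mul_eq hx, ← mul_assoc, hc, add_mul, add_mul, smul_mul_assoc,
      mul_assoc (M c) (x ^ 2), h2, pow_succ' x n]
    simp only [mul_sub, mul_assoc]
    abel
  rw [e]
  exact Submodule.add_mem _ (mul_pow_mem_ordLT n.lt_succ_self _)
    (ordLT_mono n.le_succ (mul_mem_ordLT c (pow_mul_sub_mem_ordLT hx n u)))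

lemma comm_mem_ordLT (hx : ∀ p, x * M p = M p * x + M (dz p)) (u : DiffPoly) {n : ℕ} {B : A}
    (hB : B ∈ ordLT x M n) :
    (x ^ 2 - M u) * B - B * (x ^ 2 - M u) ∈ ordLT x M (n + 1) := by
  induction hB using Submodule.span_induction with
  | mem B hB =>
    obtain ⟨i, hi, c, rfl⟩ := hB
    have h := ordLT_mono (by omega : i + 1 ≤ n + 1) (comm_mul_pow_mem_ordLT hx u c i)
    have h' : (2 : ℂ) • (M (dz c) * x ^ (i + 1)) ∈ ordLT x M (n + 1) :=
      Submodule.smul_mem _ _ (mul_pow_mem_ordLT (by omega) _)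
    have := Submodule.add_mem _ h h'
    rwa [sub_add_cancel] at this
  | zero => rw [mul_zero, zero_mul, sub_zero]; exact Submodule.zero_mem _
  | add B B' _ _ h h' =>
    have e : (x ^ 2 - M u) * (B + B') - (B + B') * (x ^ 2 - M u) =
        ((x ^ 2 - M u) * B - B * (x ^ 2 - M u)) + ((x ^ 2 - M u) * B' - B' * (x ^ 2 - M u)) := by
      rw [mul_add, add_mul]; abel
    rw [e]
    exact Submodule.add_mem _ h h'
  | smul a B _ h =>
    rw [mul_smul_comm, smul_mul_assoc, ← smul_sub]
    exact Submodule.smul_mem _ a h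

/-- A skew operator without leading term whose commutator with `L` is a multiplication operator
vanishes. -/
lemma symForm_coeff_eq_zero (hx : ∀ p, x * M p = M p * x + M (dz p))
    (hind : ∀ n c, M c * x ^ n ∈ ordLT x M n → c = 0) (u : DiffPoly) {k : ℕ} {γ : ℕ → DiffPoly}
    (hγ : ∀ j ∈ Finset.Icc 1 k, HasWeight (γ j) (2 * j)) {B : A}
    (hB : B = ∑ j ∈ Finset.Icc 1 k,
      (M (γ j) * x ^ (2 * k - 2 * j + 1) + x ^ (2 * k - 2 * j + 1) * M (γ j))) {r : DiffPoly}
    (hr : (x ^ 2 - M u) * B - B * (x ^ 2 - M u) = M r) :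
    ∀ j ∈ Finset.Icc 1 k, γ j = 0 := by
  intro j
  induction j using Nat.strongRec with
  | ind j ih =>
    intro hj
    have hj' := Finset.mem_Icc.mp hj
    set n := 2 * k - 2 * j + 1 with hn
    have hlow : B - (2 : ℂ) • (M (γ j) * x ^ n) ∈ ordLT x M n := by
      have e : B - (2 : ℂ) • (M (γ j) * x ^ n) = (∑ i ∈ (Finset.Icc 1 k).erase j,
          (M (γ i) * x ^ (2 * k - 2 * i + 1) + x ^ (2 * k - 2 * i + 1) * M (γ i)))
          + (x ^ n * M (γ j) - M (γ j) * x ^ n) := by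
        rw [hB, ← Finset.sum_erase_add _ _ hj, ← hn]
        module
      rw [e]
      refine Submodule.add_mem _ (Submodule.sum_mem _ fun i hi => ?_)
        (pow_mul_sub_mem_ordLT hx n _)
      obtain ⟨hij, hi⟩ := Finset.mem_erase.mp hi
      have hi' := Finset.mem_Icc.mp hi
      rcases lt_or_gt_of_ne hij with h | h
      · rw [ih i h hi, map_zero, zero_mul, mul_zero, add_zero]
        exact Submodule.zero_mem _
      · have h1 : M (γ i) * x ^ (2 * k - 2 * i + 1) ∈ ordLT x M n :=
          mul_pow_mem_ordLT (by omega) _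
        have h2 := ordLT_mono (by omega : 2 * k - 2 * i + 1 ≤ n)
          (pow_mul_sub_mem_ordLT hx (2 * k - 2 * i + 1) (γ i))
        have := Submodule.add_mem _ h1 (Submodule.add_mem _ h2 h1)
        rwa [sub_add_cancel] at this
    have h1 := comm_mem_ordLT hx u hlow
    have h2 := comm_mul_pow_mem_ordLT hx u (γ j) n
    have h3 : M r ∈ ordLT x M (n + 1) := by
      have := mul_pow_mem_ordLT (x := x) (M := M) n.succ_pos r
      rwa [pow_zero, mul_one] at this
    -- The leading part of `B` is `2γ_j ∂^n`, so that of `[L, B]` is `4γ_j' ∂^{n+1}`. Since `[L, B]`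
    -- has order 0, this forces `γ_j' = 0`, and the positive weight gives `γ_j = 0`.
    have h4 : M (dz (γ j)) * x ^ (n + 1) ∈ ordLT x M (n + 1) := by
      have h5 := Submodule.smul_mem _ (1 / 4 : ℂ) (Submodule.sub_mem _ h3
        (Submodule.add_mem _ h1 (Submodule.smul_mem _ (2 : ℂ) h2)))
      convert h5 using 1
      rw [← hr, mul_sub (x ^ 2 - M u), sub_mul B, mul_smul_comm, smul_mul_assoc]
      module
    exact eq_zero_of_dz_eq_zero (by omega) (hγ j hj) (hind (n + 1) _ h4)

end Order

/-! ### The operators `A_{2k+1}` and the right-hand sides of the hierarchy -/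

section LaxOperators

/-- Multiplication operators, as a homomorphism of algebras. -/
def opMulHom : DiffPoly →ₐ[ℂ] Module.End ℂ DiffPoly := Algebra.lmul ℂ DiffPoly

lemma opMulHom_apply (p : DiffPoly) : opMulHom p = opMul p := rfl

lemma opDz_mul_opMulHom (p : DiffPoly) :
    opDz * opMulHom p = opMulHom p * opDz + opMulHom (dz p) := by
  refine LinearMap.ext fun x => ?_
  change dz (p * x) = p * dz x + dz p * x
  rw [Derivation.leibniz, smul_eq_mul, smul_eq_mul, mul_comm x]

lemma dz_iterate_X (i N : ℕ) : dz^[i] (MvPolynomial.X N) = MvPolynomial.X (N + i) := by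
  induction i with
  | zero => rfl
  | succ i ih =>
    rw [Function.iterate_succ_apply', ih]
    exact MvPolynomial.mkDerivation_X ℂ _ (N + i)

lemma opMulHom_mul_pow_apply (c : DiffPoly) (i N : ℕ) :
    (opMulHom c * opDz ^ i) (MvPolynomial.X N) = c * MvPolynomial.X (N + i) := by
  rw [Module.End.mul_apply, Module.End.pow_apply, ← dz_iterate_X]
  rfl

/-- Applied to `u^{(N)}` with `N` large, an operator of order below `n` does not involve
`u^{(N+n)}`, whereas `c ∂^n` gives `c u^{(N+n)}`. -/
lemma eq_zero_of_mem_ordLT (n : ℕ) (c : DiffPoly)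
    (h : opMulHom c * opDz ^ n ∈ ordLT opDz opMulHom n) : c = 0 := by
  have key : ∀ B ∈ ordLT opDz opMulHom n,
      ∃ N₀, ∀ N ≥ N₀, MvPolynomial.pderiv (N + n) (B (MvPolynomial.X N)) = 0 := by
    intro B hB
    induction hB using Submodule.span_induction with
    | mem B hB =>
      obtain ⟨i, hi, d, rfl⟩ := hB
      obtain ⟨N₀, hN₀⟩ := exists_pderiv_eq_zero d
      refine ⟨N₀, fun N hN => ?_⟩
      rw [opMulHom_mul_pow_apply, Derivation.leibniz, hN₀ _ (by omega),
        MvPolynomial.pderiv_X_of_ne (by omega), smul_zero, smul_zero, add_zero]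
    | zero => exact ⟨0, fun N _ => by rw [LinearMap.zero_apply, map_zero]⟩
    | add B B' _ _ h h' =>
      obtain ⟨N, hN⟩ := h
      obtain ⟨N', hN'⟩ := h'
      exact ⟨max N N', fun m hm => by
        rw [LinearMap.add_apply, map_add, hN m (le_of_max_le_left hm),
          hN' m (le_of_max_le_right hm), add_zero]⟩
    | smul a B _ h =>
      obtain ⟨N, hN⟩ := h
      exact ⟨N, fun m hm => by
        rw [LinearMap.smul_apply, Derivation.map_smul, hN m hm, smul_zero]⟩
  obtain ⟨N₀, hN₀⟩ := key _ h
  obtain ⟨N₁, hN₁⟩ := exists_pderiv_eq_zero c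
  have := hN₀ (max N₀ N₁) (le_max_left _ _)
  rwa [opMulHom_mul_pow_apply, Derivation.leibniz,
    hN₁ _ ((le_max_right N₀ N₁).trans (Nat.le_add_right _ _)), MvPolynomial.pderiv_X_self,
    smul_zero, add_zero, smul_eq_mul, mul_one] at this

lemma lie_eq (P Q : Module.End ℂ DiffPoly) : ⁅P, Q⁆ = P * Q - Q * P := rfl

lemma IsLaxOperator.unique {k : ℕ} {A B : Module.End ℂ DiffPoly} (hA : IsLaxOperator k A)
    (hB : IsLaxOperator k B) : A = B := by
  obtain ⟨⟨α, hα, hA⟩, r, hr⟩ := hA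
  obtain ⟨⟨β, hβ, hB⟩, s, hs⟩ := hB
  have hAB : A - B = ∑ j ∈ Finset.Icc 1 k, (opMulHom (α j - β j) * opDz ^ (2 * k - 2 * j + 1)
      + opDz ^ (2 * k - 2 * j + 1) * opMulHom (α j - β j)) := by
    rw [hA, hB, add_sub_add_left_eq_sub, ← Finset.sum_sub_distrib]
    refine Finset.sum_congr rfl fun j _ => ?_
    rw [map_sub, sub_mul, mul_sub, opMulHom_apply, opMulHom_apply]
    abel
  have hcomm : (opDz ^ 2 - opMulHom (MvPolynomial.X 0)) * (A - B)
      - (A - B) * (opDz ^ 2 - opMulHom (MvPolynomial.X 0)) = opMulHom (r - s) := by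
    have h1 : ⁅formalL, A - B⁆ = opMulHom (r - s) := by
      rw [lie_eq, mul_sub, sub_mul, sub_sub_sub_comm, ← lie_eq, ← lie_eq, hr, hs, map_sub]; rfl
    exact h1
  have h0 := symForm_coeff_eq_zero opDz_mul_opMulHom eq_zero_of_mem_ordLT _
    (fun j hj => (hα j hj).sub (hβ j hj)) hAB hcomm
  rw [← sub_eq_zero, hAB]
  exact Finset.sum_eq_zero fun j hj => by rw [h0 j hj, map_zero, zero_mul, mul_zero, add_zero]

/-- The coefficients of the generating series with vanishing parameters. -/
def gCoeff (i : ℕ) : DiffPoly := coeff i (gSeries (T 0))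

lemma hasWeight_gCoeff (k : ℕ) : HasWeight (gCoeff k) (2 * k) := by
  cases k with
  | zero =>
    rw [gCoeff, coeff_zero_gSeries]
    exact MvPolynomial.isWeightedHomogeneous_one _ _
  | succ k =>
    rw [gCoeff, coeff_gSeries _ (Nat.le_add_left 1 k), ← neg_smul]
    exact (hasWeight_T_zero _).smul _

lemma two_smul_gCoeff {k : ℕ} (hk : 1 ≤ k) : (-2 : ℂ) • gCoeff k = T 0 k := by
  rw [gCoeff, coeff_gSeries _ hk]
  module

lemma muSeries_zero : muSeries 0 = 1 := by
  ext n
  simp [muSeries, coeff_one]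

lemma lenard_gSeries_T_zero : lenard dz (MvPolynomial.X 0) (gSeries (T 0)) = 0 := by
  refine lenard_eq_zero dz _ (constantCoeff_gSeries _) ?_
  rw [quadForm_T, muSeries_zero, map_one, mul_one]
  exact derivation_map_ofNat _ 4

lemma dz_gCoeff_succ (k : ℕ) : (4 : ℂ) • dz (gCoeff (k + 1)) =
    dz (dz (dz (gCoeff k))) - (4 : ℂ) • (MvPolynomial.X 0 * dz (gCoeff k))
      - (2 : ℂ) • (dz (MvPolynomial.X 0) * gCoeff k) := by
  have h := congrArg (coeff (k + 1)) lenard_gSeries_T_zero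
  rw [coeff_succ_lenard, map_zero] at h
  simp only [Algebra.smul_def, map_ofNat]
  simp only [gCoeff]
  linear_combination -h

/-- The operators `A_{2k+1}`. -/
def laxOperator (k : ℕ) : Module.End ℂ DiffPoly := laxOp opDz opMulHom gCoeff k

lemma two_smul_gCoeff_one : (2 : ℂ) • gCoeff 1 = -MvPolynomial.X 0 := by
  rw [← T_one 0, ← two_smul_gCoeff le_rfl]
  module

lemma lie_laxOperator (k : ℕ) : ⁅formalL, laxOperator k⁆ = opMul (dz (T 0 (k + 1))) := by
  have h := comm_laxOp opDz_mul_opMulHom two_smul_gCoeff_one (fun k _ => dz_gCoeff_succ k) k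
  rw [← map_smul, ← Derivation.map_smul, two_smul_gCoeff (Nat.le_add_left 1 k)] at h
  exact h

lemma isLaxOperator_laxOperator (k : ℕ) : IsLaxOperator k (laxOperator k) := by
  refine ⟨?_, _, lie_laxOperator k⟩
  obtain ⟨α, hα, h⟩ := symForm_laxOp opDz_mul_opMulHom two_smul_gCoeff_one
    (fun k _ => dz_gCoeff_succ k) hasWeight_gCoeff k
  exact ⟨α, hα, eq_add_of_sub_eq' h⟩

lemma opA_eq (k : ℕ) : opA k = laxOperator k :=
  (Classical.epsilon_spec (p := IsLaxOperator k) ⟨_, isLaxOperator_laxOperator k⟩).unique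
    (isLaxOperator_laxOperator k)

lemma lie_opA_apply_one (k : ℕ) : ⁅formalL, opA k⁆ 1 = dz (T 0 (k + 1)) := by
  rw [opA_eq, lie_laxOperator]
  exact mul_one _

lemma lie_add_sum_smul {A : Type*} [Ring A] [Algebra ℂ A] (x y : A) (s : Finset ℕ) (c : ℕ → ℂ)
    (f : ℕ → A) : x * (y + ∑ j ∈ s, c j • f j) - (y + ∑ j ∈ s, c j • f j) * x =
      (x * y - y * x) + ∑ j ∈ s, c j • (x * f j - f j * x) := by
  simp only [mul_add, add_mul, Finset.mul_sum, Finset.sum_mul, mul_smul_comm,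
    smul_mul_assoc, smul_sub, Finset.sum_sub_distrib]
  abel

/-- The right-hand sides of the parametric KdV hierarchy are the derivatives of the `T_k`. -/
theorem kdvRhs_eq {a μ : ℕ → ℂ} (h : muSeries a ^ 2 = muSeries μ) {k : ℕ} (hk : 1 ≤ k) :
    kdvRhs a k = dz (T μ (k + 1)) := by
  have h1 : kdvRhs a k = dz (T 0 (k + 1)) +
      ∑ j ∈ Finset.range (k - 1), a (k - j) • dz (T 0 (j + 1)) := by
    have e : ⁅formalL, opA k + ∑ j ∈ Finset.range (k - 1), a (k - j) • opA j⁆ =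
        ⁅formalL, opA k⁆ + ∑ j ∈ Finset.range (k - 1), a (k - j) • ⁅formalL, opA j⁆ :=
      lie_add_sum_smul formalL (opA k) _ (fun j => a (k - j)) opA
    rw [kdvRhs, e, LinearMap.add_apply, LinearMap.sum_apply, lie_opA_apply_one]
    congr 1
    refine Finset.sum_congr rfl fun j _ => ?_
    rw [LinearMap.smul_apply, lie_opA_apply_one]
  have h2 : dz (T μ (k + 1)) = (-2 : ℂ) • dz (coeff (k + 1) (gSeries (T μ))) := by
    rw [coeff_gSeries _ (Nat.le_add_left 1 k), map_neg, Derivation.map_smul]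
    module
  -- The series for `μ` is that for vanishing parameters times the constant series of `a`, so its
  -- coefficients are convolutions.
  have h3 : (-2 : ℂ) • dz (coeff (k + 1) (gSeries (T μ))) =
      ∑ i ∈ Finset.range (k + 2),
        coeff i (muSeries a) • ((-2 : ℂ) • dz (gCoeff (k + 1 - i))) := by
    rw [gSeries_T_eq_mul h, coeff_mul, Finset.Nat.sum_antidiagonal_eq_sum_range_succ_mk, map_sum,
      Finset.smul_sum]
    refine Finset.sum_congr rfl fun i _ => ?_
    rw [coeff_map, ← Algebra.smul_def, Derivation.map_smul, smul_comm]
    rfl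
  have h4 : ∀ j, 1 ≤ j → (-2 : ℂ) • dz (gCoeff j) = dz (T 0 j) := fun j hj => by
    rw [← two_smul_gCoeff hj, Derivation.map_smul]
  have h5 : dz (gCoeff 0) = 0 := by
    rw [gCoeff, coeff_zero_gSeries, Derivation.map_one_eq_zero]
  rw [h1, h2, h3, Finset.sum_range_succ, Nat.sub_self, h5, smul_zero, smul_zero, add_zero,
    Finset.sum_range_succ', add_comm (∑ i ∈ _, _)]
  congr 1
  · rw [Nat.sub_zero, h4 _ (by omega)]
    simp [muSeries]
  · obtain ⟨m, rfl⟩ := Nat.exists_eq_add_of_le' hk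
    rw [Nat.add_sub_cancel, Finset.sum_range_succ', ← Finset.sum_range_reflect]
    -- The series of `a` has no `ξ¹` term, which is why the sum in the hierarchy stops at `j = k -
    -- 2`.
    have hz : coeff (0 + 1) (muSeries a) = 0 := by simp [muSeries]
    rw [hz, zero_smul, add_zero]
    refine Finset.sum_congr rfl fun i hi => ?_
    rw [Finset.mem_range] at hi
    rw [h4 _ (by omega), muSeries, coeff_mk, if_neg (by omega), if_neg (by omega)]
    congr 3 <;> omega

end LaxOperators

/-! ### Finite-dimensional slices of the space of sequences -/

section Slices

lemma continuous_slice (t : Times) (n : ℕ) : Continuous (slice t n) :=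
  continuous_iff_coinduced_le.mpr
    (le_iSup₂ (f := fun (t : Times) (n : ℕ) => TopologicalSpace.coinduced (slice t n) inferInstance)
      t n)

lemma isOpen_times_iff {S : Set Times} : IsOpen S ↔ ∀ t n, IsOpen (slice t n ⁻¹' S) := by
  change @IsOpen Times
    (⨆ (t : Times) (n : ℕ), TopologicalSpace.coinduced (slice t n) inferInstance) S ↔ _
  simp only [isOpen_iSup_iff, isOpen_coinduced]

lemma slice_self (t : Times) (n : ℕ) : slice t n (fun i => t i) = t := by
  funext k
  simp only [slice]
  split_ifs <;> rfl

lemma slice_apply_of_lt (t : Times) {n k : ℕ} (h : k < n) (s : Fin n → ℂ) :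
    slice t n s k = s ⟨k, h⟩ := dif_pos h

lemma update_slice (t : Times) {n k : ℕ} (h : k < n) (s : Fin n → ℂ) (z : ℂ) :
    (Function.update (slice t n s : ℕ → ℂ) k z : Times) =
      slice t n (Function.update s ⟨k, h⟩ z) := by
  funext j
  by_cases hj : j = k
  · subst hj
    refine (Function.update_self _ _ _).trans ?_
    rw [slice_apply_of_lt _ h, Function.update_self]
  · refine (Function.update_of_ne hj _ _).trans ?_
    simp only [slice]
    split_ifs with hjn
    · rw [Function.update_of_ne]
      intro h'
      exact hj (congrArg Fin.val h')
    · rfl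

lemma slice_eq_slice (t : Times) {n m : ℕ} (h : n ≤ m) (s : Fin n → ℂ) :
    slice t n s = slice t m (fun i => if h : i.1 < n then s ⟨i, h⟩ else t i) := by
  funext k
  simp only [slice]
  by_cases hk : k < n
  · simp [hk, hk.trans_le h]
  · by_cases hm : k < m <;> simp [hk, hm]

lemma contDiff_extend (t : Times) (n m : ℕ) :
    ContDiff ℂ ∞ (fun (s : Fin n → ℂ) (i : Fin m) => if h : i.1 < n then s ⟨i, h⟩ else t i) := by
  refine contDiff_pi.mpr fun i => ?_
  by_cases h : i.1 < n
  · simp only [h, dif_pos]; exact contDiff_apply ℂ ℂ _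
  · simp only [h, dif_neg, not_false_eq_true]; exact contDiff_const

end Slices

/-! ### Holomorphic functions and their partial derivatives -/

section Holomorphic

variable {Ω : Set Times} {f g : Times → ℂ}

lemma Holo.congr (hf : Holo Ω f) (h : ∀ t ∈ Ω, g t = f t) : Holo Ω g :=
  fun t n => (hf t n).congr fun _ hs => h _ hs

lemma Holo.add (hf : Holo Ω f) (hg : Holo Ω g) : Holo Ω (f + g) :=
  fun t n => (hf t n).add (hg t n)

lemma Holo.mul (hf : Holo Ω f) (hg : Holo Ω g) : Holo Ω (f * g) :=
  fun t n => (hf t n).mul (hg t n)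

lemma holo_const (c : ℂ) : Holo Ω fun _ => c := fun _ _ => contDiffOn_const

lemma holo_apply (k : ℕ) : Holo Ω fun t => t k := by
  intro t n
  by_cases h : k < n
  · simp only [slice_apply_of_lt t h]
    exact (contDiff_apply ℂ ℂ _).contDiffOn
  · simp only [slice, h, dif_neg, not_false_eq_true]
    exact contDiffOn_const

lemma Holo.hasDerivAt (hΩ : IsOpen Ω) (hf : Holo Ω f) {t : Times} {n k : ℕ} (h : k < n)
    {s : Fin n → ℂ} (hs : slice t n s ∈ Ω) :
    HasDerivAt (fun z => f (Function.update (slice t n s : ℕ → ℂ) k z))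
      (fderiv ℂ (fun s => f (slice t n s)) s (Pi.single ⟨k, h⟩ 1)) (slice t n s k) := by
  have hU : IsOpen (slice t n ⁻¹' Ω) := hΩ.preimage (continuous_slice t n)
  have hd : DifferentiableAt ℂ (fun s => f (slice t n s)) s :=
    ((hf t n).contDiffAt (hU.mem_nhds hs)).differentiableAt (by simp)
  have he : (fun z => f (Function.update (slice t n s : ℕ → ℂ) k z)) =
      (fun s => f (slice t n s)) ∘ fun z => Function.update s ⟨k, h⟩ z := by
    funext z
    exact congrArg f (update_slice t h s z)
  rw [he, slice_apply_of_lt t h]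
  have h1 := hasDerivAt_update (𝕜 := ℂ) s ⟨k, h⟩ (s ⟨k, h⟩)
  have hd' : HasFDerivAt (fun s => f (slice t n s)) (fderiv ℂ (fun s => f (slice t n s)) s)
      (Function.update s ⟨k, h⟩ (s ⟨k, h⟩)) := by
    rw [Function.update_eq_self]; exact hd.hasFDerivAt
  exact hd'.comp_hasDerivAt _ h1

lemma Holo.pd_slice (hΩ : IsOpen Ω) (hf : Holo Ω f) {t : Times} {n k : ℕ} (h : k < n)
    {s : Fin n → ℂ} (hs : slice t n s ∈ Ω) :
    pd k f (slice t n s) = fderiv ℂ (fun s => f (slice t n s)) s (Pi.single ⟨k, h⟩ 1) :=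
  (hf.hasDerivAt hΩ h hs).deriv

lemma Holo.differentiableAt (hΩ : IsOpen Ω) (hf : Holo Ω f) {t : Times} (ht : t ∈ Ω) (k : ℕ) :
    DifferentiableAt ℂ (fun z => f (Function.update (t : ℕ → ℂ) k z)) (t k) := by
  have e := slice_self t (k + 1)
  have := (hf.hasDerivAt hΩ k.lt_succ_self (t := t) (s := fun i => t i)
    (by rwa [e])).differentiableAt
  rwa [e] at this

lemma Holo.pd (hΩ : IsOpen Ω) (hf : Holo Ω f) (k : ℕ) : Holo Ω (pd k f) := by
  intro t n
  -- The variable `t_{2k+1}` may be frozen in the given slice; a larger slice in which it varies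
  -- makes the derivative a component of a Fréchet derivative.
  set m := max n (k + 1) with hm
  have hk : k < m := by omega
  have hU : IsOpen (slice t m ⁻¹' Ω) := hΩ.preimage (continuous_slice t m)
  have h1 : ContDiffOn ℂ ∞ (fun s => KdV.pd k f (slice t m s)) (slice t m ⁻¹' Ω) := by
    have h2 : ContDiffOn ℂ ∞ (fderiv ℂ fun s => f (slice t m s)) (slice t m ⁻¹' Ω) :=
      (hf t m).fderiv_of_isOpen hU (by simp)
    exact (h2.clm_apply contDiffOn_const).congr fun s hs => hf.pd_slice hΩ hk hs
  have h3 := h1.comp (contDiff_extend t n m).contDiffOn (s := slice t n ⁻¹' Ω) (fun s hs => by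
    rw [Set.mem_preimage, ← slice_eq_slice t (by omega)]; exact hs)
  refine h3.congr fun s _ => ?_
  rw [Function.comp_apply, ← slice_eq_slice t (by omega)]

/-- As `Ω` is open, a coordinate line through a point of `Ω` stays in it for a while. So partial
derivatives on `Ω` do not depend on the values outside. -/
lemma pd_congr (hΩ : IsOpen Ω) (h : ∀ t ∈ Ω, f t = g t) {t : Times} (ht : t ∈ Ω) (k : ℕ) :
    pd k f t = pd k g t := by
  refine Filter.EventuallyEq.deriv_eq ?_
  have hc : Continuous fun z : ℂ => slice t (k + 1)
      (Function.update (fun i : Fin (k + 1) => t i) ⟨k, k.lt_succ_self⟩ z) :=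
    (continuous_slice t (k + 1)).comp (continuous_const.update _ continuous_id)
  have he : ∀ z, (Function.update (t : ℕ → ℂ) k z : Times) = slice t (k + 1)
      (Function.update (fun i : Fin (k + 1) => t i) ⟨k, k.lt_succ_self⟩ z) := by
    intro z
    rw [← update_slice, slice_self]
  have hm : ∀ᶠ z in nhds (t k), slice t (k + 1)
      (Function.update (fun i : Fin (k + 1) => t i) ⟨k, k.lt_succ_self⟩ z) ∈ Ω := by
    have e : slice t (k + 1) (Function.update (fun i : Fin (k + 1) => t i)
        ⟨k, k.lt_succ_self⟩ (t k)) = t := (he (t k)).symm.trans (Function.update_eq_self k t)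
    exact hc.continuousAt.eventually (hΩ.mem_nhds (Set.mem_of_eq_of_mem e ht))
  filter_upwards [hm] with z hz
  rw [← he] at hz
  exact h _ hz

lemma pd_comm (hΩ : IsOpen Ω) (hf : Holo Ω f) {t : Times} (ht : t ∈ Ω) (j k : ℕ) :
    pd j (pd k f) t = pd k (pd j f) t := by
  set n := max j k + 1 with hn
  have hj : j < n := by omega
  have hk : k < n := by omega
  set s₀ : Fin n → ℂ := fun i => t i with hs₀
  have e : slice t n s₀ = t := slice_self t n
  have hU : IsOpen (slice t n ⁻¹' Ω) := hΩ.preimage (continuous_slice t n)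
  have hs : slice t n s₀ ∈ Ω := by rwa [e]
  set F := fun s => f (slice t n s) with hF
  have hFs : ContDiffAt ℂ ∞ F s₀ := (hf t n).contDiffAt (hU.mem_nhds hs)
  have hd : DifferentiableAt ℂ (fderiv ℂ F) s₀ :=
    (hFs.fderiv_right (m := ∞) (by simp)).differentiableAt (by simp)
  have key : ∀ {i l : ℕ} (hi : i < n) (hl : l < n), pd i (pd l f) t =
      fderiv ℂ (fderiv ℂ F) s₀ (Pi.single ⟨i, hi⟩ 1) (Pi.single ⟨l, hl⟩ 1) := by
    intro i l hi hl
    have h1 : pd i (pd l f) t = fderiv ℂ (fun s => pd l f (slice t n s)) s₀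
        (Pi.single ⟨i, hi⟩ 1) := by
      rw [← (hf.pd hΩ l).pd_slice hΩ hi hs, e]
    have h2 : (fun s => pd l f (slice t n s)) =ᶠ[nhds s₀]
        fun s => fderiv ℂ F s (Pi.single ⟨l, hl⟩ 1) := by
      filter_upwards [hU.mem_nhds hs] with s hs using hf.pd_slice hΩ hl hs
    rw [h1, h2.fderiv_eq, fderiv_clm_apply hd (differentiableAt_const _)]
    simp
  rw [key hj hk, key hk hj]
  have h2 : minSmoothness ℂ 2 ≤ ∞ := by
    rw [minSmoothness_of_isRCLikeNormedField]
    exact WithTop.coe_le_coe.mpr (le_top : (2 : ℕ∞) ≤ ⊤)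
  exact (hFs.isSymmSndFDerivAt h2).eq _ _

/-- A holomorphic function all of whose partial derivatives vanish is constant on a connected open
set. -/
lemma eq_of_pd_eq_zero (hΩ : IsOpen Ω) (hconn : IsPreconnected Ω) (hf : Holo Ω f)
    (h : ∀ k, ∀ t ∈ Ω, pd k f t = 0) {t t' : Times} (ht : t ∈ Ω) (ht' : t' ∈ Ω) :
    f t' = f t := by
  -- On every slice `f` has zero Fréchet derivative and is locally constant; in the finite topology
  -- this makes any condition on the value of `f` open.
  have hopen : ∀ P : ℂ → Prop, IsOpen {t | t ∈ Ω ∧ P (f t)} := by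
    intro P
    refine isOpen_times_iff.mpr fun t n => Metric.isOpen_iff.mpr ?_
    rintro s ⟨hs, hPs⟩
    have hU : IsOpen (slice t n ⁻¹' Ω) := hΩ.preimage (continuous_slice t n)
    obtain ⟨ε, hε, hball⟩ := Metric.isOpen_iff.mp hU s hs
    refine ⟨ε, hε, fun s' hs' => ⟨hball hs', ?_⟩⟩
    have hconst : f (slice t n s') = f (slice t n s) := by
      refine Metric.isOpen_ball.is_const_of_fderiv_eq_zero (𝕜 := ℂ)
        (f := fun s => f (slice t n s))
        (convex_ball s ε).isPreconnected
        (((hf t n).mono hball).differentiableOn (by simp)) ?_ hs' (Metric.mem_ball_self hε)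
      intro x hx
      refine ContinuousLinearMap.coe_injective (LinearMap.pi_ext' fun i => LinearMap.ext_ring ?_)
      have := hf.pd_slice hΩ i.2 (hball hx)
      rw [h _ _ (hball hx)] at this
      simpa using this.symm
    rw [hconst]
    exact hPs
  have hsub := hconn.subset_left_of_subset_union (hopen fun z => z = f t)
    (hopen fun z => z ≠ f t) ?_ ?_ ⟨t, ht, ht, rfl⟩
  · exact (hsub ht').2
  · rw [Set.disjoint_left]
    rintro x ⟨-, hx⟩ ⟨-, hx'⟩
    exact hx' hx
  · intro x hx
    by_cases hxt : f x = f t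
    · exact Or.inl ⟨hx, hxt⟩
    · exact Or.inr ⟨hx, hxt⟩

end Holomorphic

/-! ### The differential algebra of holomorphic functions on `Ω` -/

section HoloRing

/-- The algebra of holomorphic functions on `Ω`. -/
def holoRing (Ω : Set Times) : Subalgebra ℂ (Ω → ℂ) where
  carrier := {f | ∃ F, Holo Ω F ∧ ∀ t : Ω, f t = F t}
  mul_mem' := by
    rintro _ _ ⟨F, hF, hF'⟩ ⟨G, hG, hG'⟩
    exact ⟨F * G, hF.mul hG, fun t => by rw [Pi.mul_apply, hF', hG']; rfl⟩
  add_mem' := by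
    rintro _ _ ⟨F, hF, hF'⟩ ⟨G, hG, hG'⟩
    exact ⟨F + G, hF.add hG, fun t => by rw [Pi.add_apply, hF', hG']; rfl⟩
  algebraMap_mem' := fun c => ⟨fun _ => c, holo_const c, fun _ => rfl⟩

variable {Ω : Set Times}

/-- The restriction of a holomorphic function to `Ω`. -/
def res {f : Times → ℂ} (hf : Holo Ω f) : holoRing Ω := ⟨fun t => f t, f, hf, fun _ => rfl⟩

lemma res_apply {f : Times → ℂ} (hf : Holo Ω f) (t : Ω) : (res hf).1 t = f t := rfl

/-- An extension of an element of `holoRing Ω` to a function of all sequences. -/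
def extn (f : holoRing Ω) : Times → ℂ := f.2.choose

lemma holo_extn (f : holoRing Ω) : Holo Ω (extn f) := f.2.choose_spec.1

lemma extn_apply (f : holoRing Ω) (t : Ω) : extn f t = f.1 t := (f.2.choose_spec.2 t).symm

lemma res_extn (f : holoRing Ω) : res (holo_extn f) = f :=
  Subtype.ext (funext fun t => extn_apply f t)

lemma pd_add_apply (hΩ : IsOpen Ω) {f g : Times → ℂ} (hf : Holo Ω f) (hg : Holo Ω g) (k : ℕ)
    {t : Times} (ht : t ∈ Ω) : pd k (f + g) t = pd k f t + pd k g t :=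
  deriv_add (hf.differentiableAt hΩ ht k) (hg.differentiableAt hΩ ht k)

lemma pd_mul_apply (hΩ : IsOpen Ω) {f g : Times → ℂ} (hf : Holo Ω f) (hg : Holo Ω g) (k : ℕ)
    {t : Times} (ht : t ∈ Ω) : pd k (f * g) t = pd k f t * g t + f t * pd k g t := by
  have h := deriv_mul (hf.differentiableAt hΩ ht k) (hg.differentiableAt hΩ ht k)
  have e : Function.update (t : ℕ → ℂ) k (t k) = t := Function.update_eq_self k t
  rw [e] at h
  exact h

/-- The partial derivatives as derivations of the algebra of holomorphic functions on `Ω`. -/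
def pdRing (hΩ : IsOpen Ω) (k : ℕ) : Derivation ℂ (holoRing Ω) (holoRing Ω) :=
  Derivation.mk'
    { toFun := fun f => res ((holo_extn f).pd hΩ k)
      map_add' := fun f g => by
        refine Subtype.ext (funext fun t => ?_)
        have h := pd_congr hΩ (f := extn (f + g)) (g := extn f + extn g) (fun t ht => by
          rw [Pi.add_apply, extn_apply _ ⟨t, ht⟩, extn_apply _ ⟨t, ht⟩, extn_apply _ ⟨t, ht⟩]
          rfl) t.2 k
        rw [pd_add_apply hΩ (holo_extn f) (holo_extn g) k t.2] at h
        exact h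
      map_smul' := fun c f => by
        refine Subtype.ext (funext fun t => ?_)
        have h := pd_congr hΩ (f := extn (c • f)) (g := c • extn f) (fun t ht => by
          rw [Pi.smul_apply, extn_apply _ ⟨t, ht⟩, extn_apply _ ⟨t, ht⟩]
          rfl) t.2 k
        exact h.trans (deriv_const_smul c ((holo_extn f).differentiableAt hΩ t.2 k)) }
    (fun f g => by
      refine Subtype.ext (funext fun t => ?_)
      have h := pd_congr hΩ (f := extn (f * g)) (g := extn f * extn g) (fun t ht => by
        rw [Pi.mul_apply, extn_apply _ ⟨t, ht⟩, extn_apply _ ⟨t, ht⟩, extn_apply _ ⟨t, ht⟩]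
        rfl) t.2 k
      rw [pd_mul_apply hΩ (holo_extn f) (holo_extn g) k t.2, extn_apply, extn_apply] at h
      refine h.trans ?_
      change _ = f.1 t * pd k (extn g) t + g.1 t * pd k (extn f) t
      ring)

lemma pdRing_res (hΩ : IsOpen Ω) (k : ℕ) {f : Times → ℂ} (hf : Holo Ω f) :
    pdRing hΩ k (res hf) = res (hf.pd hΩ k) :=
  Subtype.ext (funext fun t =>
    pd_congr hΩ (fun t ht => extn_apply (res hf) ⟨t, ht⟩) t.2 k)

lemma pdRing_comm (hΩ : IsOpen Ω) (j k : ℕ) (f : holoRing Ω) :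
    pdRing hΩ j (pdRing hΩ k f) = pdRing hΩ k (pdRing hΩ j f) := by
  rw [← res_extn f]
  simp only [pdRing_res]
  exact Subtype.ext (funext fun t => pd_comm hΩ (holo_extn f) t.2 j k)

lemma pdRing_coordinate (hΩ : IsOpen Ω) (k : ℕ) :
    pdRing hΩ k (res (holo_apply k)) = 1 := by
  rw [pdRing_res]
  refine Subtype.ext (funext fun t => ?_)
  have e : (fun z => (Function.update (t.1 : ℕ → ℂ) k z : Times) k) = fun z => z :=
    funext fun z => Function.update_self _ _ _
  rw [res_apply, pd, e]
  exact deriv_id _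

lemma exists_algebraMap_of_pdRing_eq_zero (hΩ : IsOpen Ω) (hconn : IsConnected Ω) {f : holoRing Ω}
    (h : ∀ k, pdRing hΩ k f = 0) : ∃ c : ℂ, f = algebraMap ℂ (holoRing Ω) c := by
  obtain ⟨t₀, ht₀⟩ := hconn.nonempty
  refine ⟨f.1 ⟨t₀, ht₀⟩, Subtype.ext (funext fun t => ?_)⟩
  have h1 : ∀ k, ∀ t ∈ Ω, pd k (extn f) t = 0 := fun k t ht =>
    congrFun (congrArg Subtype.val (h k)) ⟨t, ht⟩
  have := eq_of_pd_eq_zero hΩ hconn.isPreconnected (holo_extn f) h1 ht₀ t.2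
  rw [extn_apply, extn_apply f ⟨t₀, ht₀⟩] at this
  exact this

end HoloRing

/-! ### Substitution into differential polynomials and constancy of the form -/

section Substitution

variable {R : Type*} [CommRing R] [Algebra ℂ R]

/-- The homomorphism of differential algebras with `u ↦ r`. -/
def diffHom (d : Derivation ℂ R R) (r : R) : DiffPoly →ₐ[ℂ] R := MvPolynomial.aeval fun j => d^[j] r

lemma diffHom_X_zero (d : Derivation ℂ R R) (r : R) : diffHom d r (MvPolynomial.X 0) = r := by
  rw [diffHom, MvPolynomial.aeval_X]; rfl

lemma diffHom_dz (d : Derivation ℂ R R) (r : R) (p : DiffPoly) :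
    diffHom d r (dz p) = d (diffHom d r p) := by
  induction p using MvPolynomial.induction_on with
  | C a =>
    rw [← MvPolynomial.algebraMap_eq, Derivation.map_algebraMap, map_zero, AlgHom.commutes,
      Derivation.map_algebraMap]
  | add p q hp hq => simp only [map_add, hp, hq]
  | mul_X p i hp =>
    have h1 : dz (MvPolynomial.X i) = MvPolynomial.X (i + 1) :=
      MvPolynomial.mkDerivation_X ℂ _ i
    have h2 : diffHom d r (MvPolynomial.X (i + 1)) = d (diffHom d r (MvPolynomial.X i)) := by
      rw [diffHom, MvPolynomial.aeval_X, MvPolynomial.aeval_X, Function.iterate_succ_apply']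
    simp only [Derivation.leibniz, map_add, map_mul, smul_eq_mul, hp, h1, h2]

lemma map_serD (d : Derivation ℂ R R) (r : R) (f : DiffPoly⟦X⟧) :
    PowerSeries.map (diffHom d r : DiffPoly →+* R) (serD dz f) =
      serD d (PowerSeries.map (diffHom d r : DiffPoly →+* R) f) := by
  ext n
  rw [coeff_map, coeff_serD, coeff_serD, coeff_map]
  exact diffHom_dz d r _

lemma map_quadForm (d : Derivation ℂ R R) (r : R) (G : DiffPoly⟦X⟧) :
    PowerSeries.map (diffHom d r : DiffPoly →+* R) (quadForm dz (MvPolynomial.X 0) G) =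
      quadForm d r (PowerSeries.map (diffHom d r : DiffPoly →+* R) G) := by
  have h : (diffHom d r : DiffPoly →+* R) (MvPolynomial.X 0) = r := diffHom_X_zero d r
  simp only [quadForm, map_add, map_sub, map_mul, map_pow, map_serD, PowerSeries.map_X,
    PowerSeries.map_C, h, map_ofNat, map_one]

/-- The quadratic form of the generating series of `V` is the constant series with parameters `μ`
exactly if `V` is obtained from the recursion. -/
theorem quadForm_eq_iff (d : Derivation ℂ R R) (V : ℕ → R) (μ : ℕ → ℂ) :
    quadForm d (V 1) (gSeries V) = 4 * PowerSeries.map (algebraMap ℂ R) (muSeries μ) ↔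
      ∀ k, 2 ≤ k → V k = diffHom d (V 1) (T μ k) := by
  set σ : DiffPoly →+* R := (diffHom d (V 1) : DiffPoly →+* R)
  have hT : quadForm d (V 1) (PowerSeries.map σ (gSeries (T μ))) =
      4 * PowerSeries.map (algebraMap ℂ R) (muSeries μ) := by
    rw [← map_quadForm, quadForm_T, map_mul, map_ofNat]
    congr 1
    ext n
    simp only [coeff_map]
    exact (diffHom d (V 1)).commutes _
  have hg : ∀ {k}, 1 ≤ k → -2 * σ (coeff k (gSeries (T μ))) = σ (T μ k) := fun {k} hk => by
    rw [eq_neg_two_mul_coeff_gSeries (T μ) hk, map_mul, map_neg, map_ofNat]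
  constructor
  · intro h k hk
    have := quadForm_injective d (V 1) (constantCoeff_gSeries V)
      (H := PowerSeries.map σ (gSeries (T μ))) ?_ (h.trans hT.symm)
    · rw [eq_neg_two_mul_coeff_gSeries V (by omega), this, coeff_map, hg (by omega)]; rfl
    · rw [← coeff_zero_eq_constantCoeff_apply, coeff_map, coeff_zero_gSeries, map_one]
  · intro h
    rw [← hT]
    congr 1
    ext n
    rw [coeff_map]
    rcases Nat.eq_zero_or_pos n with rfl | hn
    · rw [coeff_zero_gSeries, coeff_zero_gSeries, map_one]
    · have hV : V n = σ (T μ n) := by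
        rcases Nat.lt_or_ge n 2 with h2 | h2
        · obtain rfl : n = 1 := by omega
          rw [T_one]; exact (diffHom_X_zero d (V 1)).symm
        · exact h n h2
      rw [coeff_gSeries V hn, coeff_gSeries _ hn, hV, map_neg]
      exact congrArg Neg.neg (map_smul (diffHom d (V 1)) (1 / 2 : ℂ) (T μ n)).symm

lemma coeff_quadForm_zero (d : Derivation ℂ R R) (V : ℕ → R) :
    coeff 0 (quadForm d (V 1) (gSeries V)) = 4 := by
  rw [coeff_zero_eq_constantCoeff_apply, quadForm]
  simp only [map_add, map_sub, map_mul, map_pow, map_ofNat, map_one, constantCoeff_X,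
    constantCoeff_gSeries]
  ring

/-- The contribution `4v₂` of the potential cancels `8 g₁ = -4v₂` from `4G²`. Hence there is no
parameter `μ₂`. -/
lemma coeff_quadForm_one (d : Derivation ℂ R R) (V : ℕ → R) :
    coeff 1 (quadForm d (V 1) (gSeries V)) = 0 := by
  set G := gSeries V with hG
  have e : quadForm d (V 1) G = X * (serD d G ^ 2 - 2 * G * serD d (serD d G)
      + 4 * C (V 1) * G ^ 2) + C 4 * (G * G) := by
    rw [quadForm, map_ofNat]; ring
  have h0 : constantCoeff G = 1 := constantCoeff_gSeries V
  have h1 : constantCoeff (serD d G) = 0 := by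
    rw [← coeff_zero_eq_constantCoeff_apply, coeff_serD, coeff_zero_eq_constantCoeff_apply, h0,
      Derivation.map_one_eq_zero]
  have h2 : constantCoeff (serD d (serD d G)) = 0 := by
    rw [← coeff_zero_eq_constantCoeff_apply, coeff_serD, coeff_zero_eq_constantCoeff_apply, h1,
      map_zero]
  rw [e, map_add, coeff_succ_X_mul, coeff_C_mul, coeff_mul,
    Finset.Nat.sum_antidiagonal_eq_sum_range_succ_mk, coeff_zero_eq_constantCoeff_apply]
  simp only [Finset.sum_range_succ, Finset.sum_range_zero, Nat.sub_zero, Nat.sub_self, zero_add,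
    coeff_zero_eq_constantCoeff_apply, map_add, map_sub, map_mul, map_pow, h0, h1, h2,
    constantCoeff_C, map_ofNat]
  rw [eq_neg_two_mul_coeff_gSeries V le_rfl, ← hG]
  ring

/-- A series killed by all derivations has constant coefficients, and the first two automatically
agree with those of `4 * muSeries μ`; the others define `μ`. -/
lemma exists_quadForm_eq_iff {D : ℕ → Derivation ℂ R R}
    (hconst : ∀ x, (∀ k, D k x = 0) → ∃ c : ℂ, x = algebraMap ℂ R c) (V : ℕ → R) :
    (∃ μ, quadForm (D 0) (V 1) (gSeries V) = 4 * PowerSeries.map (algebraMap ℂ R) (muSeries μ)) ↔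
      ∀ k, serD (D k) (quadForm (D 0) (V 1) (gSeries V)) = 0 := by
  have e4 : (4 : R⟦X⟧) = C 4 := by rw [map_ofNat]
  constructor
  · rintro ⟨μ, h⟩ k
    ext n
    rw [h, e4, coeff_serD, coeff_C_mul, coeff_map, ← map_ofNat (algebraMap ℂ R) 4, ← map_mul,
      Derivation.map_algebraMap, map_zero]
  · intro h
    have hc : ∀ n, ∃ c : ℂ, coeff n (quadForm (D 0) (V 1) (gSeries V)) = algebraMap ℂ R c := by
      refine fun n => hconst _ fun k => ?_
      rw [← coeff_serD, h, map_zero]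
    choose c hc using hc
    refine ⟨fun n => c n / 4, ?_⟩
    rw [e4]
    ext n
    rw [coeff_C_mul, coeff_map]
    match n with
    | 0 => rw [coeff_quadForm_zero]; simp [muSeries]
    | 1 => rw [coeff_quadForm_one]; simp [muSeries]
    | n + 2 =>
      rw [hc, muSeries, coeff_mk, if_neg (by omega), if_neg (by omega),
        ← map_ofNat (algebraMap ℂ R) 4, ← map_mul]
      congr 1
      ring

end Substitution

/-! ### Translation of the three conditions into the differential algebra -/

section Transfer

variable {Ω : Set Times}

/-- Evaluation at a point of `Ω`. -/
def evalAt (t : Ω) : holoRing Ω →ₐ[ℂ] ℂ := (Pi.evalAlgHom ℂ (fun _ : Ω => ℂ) t).comp (holoRing Ω).val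

lemma holoRing_ext {f g : holoRing Ω} (h : ∀ t, evalAt t f = evalAt t g) : f = g :=
  Subtype.ext (funext h)

lemma evalAt_res {f : Times → ℂ} (hf : Holo Ω f) (t : Ω) : evalAt t (res hf) = f t := rfl

lemma holoRing_forall {P : holoRing Ω → Prop} :
    (∀ f, P f) ↔ ∀ (f : Times → ℂ) (hf : Holo Ω f), P (res hf) :=
  ⟨fun h _ _ => h _, fun h f => by rw [← res_extn f]; exact h _ _⟩

variable {v : ℕ → Times → ℂ}

open Classical in
/-- The sequence `v` as a sequence in the algebra of holomorphic functions on `Ω`. -/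
def seqRes (hv : ∀ k, 1 ≤ k → Holo Ω (v k)) (k : ℕ) : holoRing Ω :=
  -- Nothing is known about `v 0`, so the unused entry is set to 0.
  if h : 1 ≤ k then res (hv k h) else 0

lemma seqRes_eq (hv : ∀ k, 1 ≤ k → Holo Ω (v k)) {k : ℕ} (h : 1 ≤ k) :
    seqRes hv k = res (hv k h) := dif_pos h

lemma Holo.opL (hΩ : IsOpen Ω) (hv : Holo Ω (v 1)) {φ : Times → ℂ} (hφ : Holo Ω φ) :
    ∃ h : Holo Ω (opL v φ), res h = schrodinger (pdRing hΩ 0) (res hv) (res hφ) := by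
  have e : ∀ t : Ω, evalAt t (schrodinger (pdRing hΩ 0) (res hv) (res hφ)) = KdV.opL v φ t := by
    intro t
    rw [schrodinger, pdRing_res, pdRing_res, map_sub, map_mul]
    rfl
  have h : Holo Ω (KdV.opL v φ) := by
    refine (holo_extn (schrodinger (pdRing hΩ 0) (res hv) (res hφ))).congr fun t ht => ?_
    rw [extn_apply _ ⟨t, ht⟩]
    exact (e ⟨t, ht⟩).symm
  exact ⟨h, holoRing_ext fun t => (e t).symm⟩

lemma res_mul {f g : Times → ℂ} (hf : Holo Ω f) (hg : Holo Ω g) :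
    res hf * res hg = res (hf.mul hg) := rfl

lemma Holo.opB (hΩ : IsOpen Ω) {k : ℕ} (hv : Holo Ω (v 1)) (hw : Holo Ω (v k)) {φ : Times → ℂ}
    (hφ : Holo Ω φ) :
    ∃ h : Holo Ω (opB v k φ), res h =
      shorina (pdRing hΩ 0) (pdRing hΩ (k - 1)) (pdRing hΩ k) (res hv) (res hw) (res hφ) := by
  have e : ∀ t : Ω, evalAt t (shorina (pdRing hΩ 0) (pdRing hΩ (k - 1)) (pdRing hΩ k) (res hv)
      (res hw) (res hφ)) = KdV.opB v k φ t := by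
    intro t
    rw [shorina, res_mul, res_mul]
    simp only [pdRing_res, map_sub, map_add, map_smul, map_mul]
    rfl
  have h : Holo Ω (KdV.opB v k φ) := by
    refine (holo_extn (shorina (pdRing hΩ 0) (pdRing hΩ (k - 1)) (pdRing hΩ k) (res hv)
      (res hw) (res hφ))).congr fun t ht => ?_
    rw [extn_apply _ ⟨t, ht⟩]
    exact (e ⟨t, ht⟩).symm
  exact ⟨h, holoRing_ext fun t => (e t).symm⟩

/-- Commutation of operators on holomorphic functions, in terms of the operators they induce on the
algebra of holomorphic functions. -/
lemma commuteOn_iff {P Q : (Times → ℂ) → Times → ℂ} {P' Q' : holoRing Ω → holoRing Ω}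
    (hP : ∀ φ (hφ : Holo Ω φ), ∃ h : Holo Ω (P φ), res h = P' (res hφ))
    (hQ : ∀ φ (hφ : Holo Ω φ), ∃ h : Holo Ω (Q φ), res h = Q' (res hφ)) :
    CommuteOn Ω P Q ↔ ∀ φ, P' (Q' φ) = Q' (P' φ) := by
  rw [holoRing_forall]
  refine forall_congr' fun φ => forall_congr' fun hφ => ?_
  obtain ⟨h1, e1⟩ := hP φ hφ
  obtain ⟨h2, e2⟩ := hQ φ hφ
  obtain ⟨h3, e3⟩ := hP _ h2
  obtain ⟨h4, e4⟩ := hQ _ h1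
  rw [← e1, ← e2, ← e3, ← e4]
  exact ⟨fun h => holoRing_ext fun t => h t t.2,
    fun h t ht => congrArg (evalAt ⟨t, ht⟩) h⟩

lemma allCommute_iff (hΩ : IsOpen Ω) (hv : ∀ k, 1 ≤ k → Holo Ω (v k)) :
    AllCommute Ω v ↔ RingCommute (pdRing hΩ) (seqRes hv) := by
  have hL : ∀ φ (hφ : Holo Ω φ), ∃ h : Holo Ω (opL v φ),
      res h = schrodinger (pdRing hΩ 0) (seqRes hv 1) (res hφ) := fun φ hφ => by
    rw [seqRes_eq hv le_rfl]; exact Holo.opL hΩ _ hφ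
  have hB : ∀ {k}, 1 ≤ k → ∀ φ (hφ : Holo Ω φ), ∃ h : Holo Ω (opB v k φ),
      res h = shorina (pdRing hΩ 0) (pdRing hΩ (k - 1)) (pdRing hΩ k) (seqRes hv 1)
        (seqRes hv k) (res hφ) := fun {k} hk φ hφ => by
    rw [seqRes_eq hv le_rfl, seqRes_eq hv hk]; exact Holo.opB hΩ _ _ hφ
  refine and_congr (forall_congr' fun k => forall_congr' fun hk => ?_)
    (forall_congr' fun j => forall_congr' fun k => forall_congr' fun hj => forall_congr' fun hk =>
      ?_)
  · exact commuteOn_iff hL (hB hk)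
  · exact commuteOn_iff (hB hj) (hB hk)

lemma evalAt_pdRing_seqRes (hΩ : IsOpen Ω) (hv : ∀ k, 1 ≤ k → Holo Ω (v k)) (j : ℕ) {k : ℕ}
    (hk : 1 ≤ k) (t : Ω) : evalAt t (pdRing hΩ j (seqRes hv k)) = pd j (v k) t := by
  rw [seqRes_eq hv hk, pdRing_res]; rfl

lemma genSeries_eq {w : ℕ → ℂ} {p : ℂ⟦X⟧} (h0 : coeff 0 p = 0)
    (h : ∀ i, 1 ≤ i → coeff i p = (1 / 2) * w i) :
    genSeries w = HahnSeries.ofPowerSeries ℤ ℂ p := by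
  rw [genSeries]
  congr 1
  ext i
  rw [coeff_mk]
  split_ifs with hi
  · rw [hi, h0]
  · rw [h i (Nat.one_le_iff_ne_zero.mpr hi)]

/-- Multiplication by the unit `ξ` turns the Laurent relation into one between power series, which
embed into Laurent series. In terms of `G` one has `𝐛₁ = 1 - G`, `𝐛₂ = -G'`, `𝐛₃ = -G''`. -/
lemma genRelation_iff (hΩ : IsOpen Ω) (hv : ∀ k, 1 ≤ k → Holo Ω (v k)) (μ : ℕ → ℂ) :
    GenRelation Ω v μ ↔ quadForm (pdRing hΩ 0) (seqRes hv 1) (gSeries (seqRes hv)) =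
      4 * PowerSeries.map (algebraMap ℂ (holoRing Ω)) (muSeries μ) := by
  set d := pdRing hΩ 0 with hd
  set V := seqRes hv with hV
  set G := gSeries V with hG
  set o := HahnSeries.ofPowerSeries ℤ ℂ with ho
  have hX : ξinv * o X = 1 := by
    rw [ho, HahnSeries.ofPowerSeries_X, ξinv, HahnSeries.single_mul_single]
    simp
  have key : ∀ t : Ω, 4 * mSeries μ = b₂ v t ^ 2 + 2 * b₃ v t * (1 - b₁ v t)
      + 4 * (ξinv + HahnSeries.C (v 1 t)) * (1 - b₁ v t) ^ 2 ↔
      PowerSeries.map (evalAt t : holoRing Ω →+* ℂ) (quadForm d (V 1) G) = 4 * muSeries μ := by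
    intro t
    set ev : holoRing Ω →+* ℂ := (evalAt t : holoRing Ω →+* ℂ) with hev
    set g := PowerSeries.map ev G with hg
    set g' := PowerSeries.map ev (serD d G) with hg'
    set g'' := PowerSeries.map ev (serD d (serD d G)) with hg''
    have hev_smul : ∀ (c : ℂ) x, ev (c • x) = c * ev x := fun c x => map_smul (evalAt t) c x
    have h1 : b₁ v t = o (1 - g) := by
      refine genSeries_eq ?_ fun i hi => ?_
      · rw [map_sub, hg, coeff_map, coeff_zero_gSeries, RingHom.map_one, coeff_zero_one,
          sub_self]
      · rw [map_sub, hg, coeff_map, coeff_gSeries V hi, map_neg, hev_smul, coeff_one,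
          if_neg (by omega), hV, seqRes_eq hv hi]
        change 0 - -((1 / 2) * v i t) = _
        ring
    have h2 : b₂ v t = o (-g') := by
      refine genSeries_eq ?_ fun i hi => ?_
      · rw [map_neg, hg', coeff_map, coeff_serD, coeff_zero_gSeries, Derivation.map_one_eq_zero,
          map_zero, neg_zero]
      · rw [map_neg, hg', coeff_map, coeff_serD, coeff_gSeries V hi, map_neg, map_neg,
          Derivation.map_smul, hev_smul, neg_neg, hV, seqRes_eq hv hi, hd, pdRing_res]
        rfl
    have h3 : b₃ v t = o (-g'') := by
      refine genSeries_eq ?_ fun i hi => ?_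
      · rw [map_neg, hg'', coeff_map, coeff_serD, coeff_serD, coeff_zero_gSeries,
          Derivation.map_one_eq_zero, map_zero, map_zero, neg_zero]
      · rw [map_neg, hg'', coeff_map, coeff_serD, coeff_serD, coeff_gSeries V hi, map_neg, map_neg,
          map_neg, Derivation.map_smul, Derivation.map_smul, hev_smul, neg_neg, hV,
          seqRes_eq hv hi, hd, pdRing_res, pdRing_res]
        rfl
    have hm : o X * mSeries μ = o (muSeries μ) := by
      have hmu : muSeries μ = 1 + X * PowerSeries.mk fun i => if i = 0 then 0 else μ (i + 1) := by
        ext i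
        match i with
        | 0 => simp [muSeries]
        | 1 => rw [map_add, coeff_succ_X_mul]; simp [muSeries, coeff_one]
        | i + 2 => rw [map_add, coeff_succ_X_mul]; simp [muSeries, coeff_one]
      rw [hmu, mSeries, map_add, map_mul, map_one, mul_add, mul_comm (o X) ξinv, hX]
    have hv1 : HahnSeries.C (v 1 t) = o (C (v 1 t)) := (HahnSeries.ofPowerSeries_C _).symm
    have hq : PowerSeries.map ev (quadForm d (V 1) G) =
        X * g' ^ 2 - 2 * X * g * g'' + 4 * (1 + X * C (v 1 t)) * g ^ 2 := by
      have : ev (V 1) = v 1 t := by rw [hV, seqRes_eq hv le_rfl]; rfl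
      simp only [quadForm, map_add, map_sub, map_mul, map_pow, PowerSeries.map_X,
        PowerSeries.map_C, map_ofNat, map_one, this, hg, hg', hg'']
    have hXu : IsUnit (o X) := IsUnit.of_mul_eq_one_right _ hX
    rw [hq, ← hXu.mul_right_inj, ← (HahnSeries.ofPowerSeries_injective (Γ := ℤ)
      (R := ℂ)).eq_iff, ← ho, h1, h2, h3, hv1]
    have e1 : o X * (4 * mSeries μ) = o (4 * muSeries μ) := by
      rw [map_mul, ← hm, map_ofNat]; ring
    have e2 : o X * (o (-g') ^ 2 + 2 * o (-g'') * (1 - o (1 - g))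
        + 4 * (ξinv + o (C (v 1 t))) * (1 - o (1 - g)) ^ 2) =
        o (X * g' ^ 2 - 2 * X * g * g'' + 4 * (1 + X * C (v 1 t)) * g ^ 2) := by
      simp only [map_add, map_sub, map_mul, map_pow, map_neg, map_one, map_ofNat]
      linear_combination 4 * o g ^ 2 * hX
    rw [e1, e2]
    exact eq_comm
  constructor
  · intro h
    ext1 n
    refine holoRing_ext fun t => ?_
    have := congrArg (coeff n) ((key t).mp (h t t.2))
    rw [coeff_map] at this
    refine Eq.trans this ?_
    have e4 : (4 : (holoRing Ω)⟦X⟧) = C 4 := by rw [map_ofNat]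
    have e4' : (4 : ℂ⟦X⟧) = C 4 := by rw [map_ofNat]
    rw [e4, e4', coeff_C_mul, coeff_C_mul, coeff_map, map_mul, map_ofNat, AlgHom.commutes]
    rfl
  · intro h t ht
    refine (key ⟨t, ht⟩).mpr ?_
    rw [h, map_mul, map_ofNat]
    congr 1

lemma conditionGen_iff (hΩ : IsOpen Ω) (hv : ∀ k, 1 ≤ k → Holo Ω (v k)) :
    ConditionGen Ω v ↔
      (∀ k, 1 ≤ k → pdRing hΩ k (seqRes hv 1) = pdRing hΩ 0 (seqRes hv (k + 1))) ∧
      ∃ μ, quadForm (pdRing hΩ 0) (seqRes hv 1) (gSeries (seqRes hv)) =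
        4 * PowerSeries.map (algebraMap ℂ (holoRing Ω)) (muSeries μ) := by
  refine and_congr (forall_congr' fun k => forall_congr' fun hk => ?_)
    (exists_congr fun μ => genRelation_iff hΩ hv μ)
  have h1 := evalAt_pdRing_seqRes hΩ hv k le_rfl
  have h2 := evalAt_pdRing_seqRes hΩ hv 0 (Nat.le_add_left 1 k)
  constructor
  · intro h
    exact holoRing_ext fun t => by rw [h1, h2]; exact h t t.2
  · intro h t ht
    rw [← h1 ⟨t, ht⟩, ← h2 ⟨t, ht⟩, h]

lemma iterate_pdRing_res (hΩ : IsOpen Ω) {f : Times → ℂ} (hf : Holo Ω f) (j : ℕ) :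
    ∃ h : Holo Ω ((pd 0)^[j] f), (pdRing hΩ 0)^[j] (res hf) = res h := by
  induction j with
  | zero => exact ⟨hf, rfl⟩
  | succ j ih =>
    obtain ⟨h, e⟩ := ih
    rw [Function.iterate_succ_apply']
    exact ⟨h.pd hΩ 0, by rw [Function.iterate_succ_apply', e, pdRing_res]⟩

lemma evalAt_diffHom (hΩ : IsOpen Ω) {f : Times → ℂ} (hf : Holo Ω f) (p : DiffPoly) (t : Ω) :
    evalAt t (diffHom (pdRing hΩ 0) (res hf) p) = subst f p t := by
  rw [subst, diffHom, ← AlgHom.comp_apply, MvPolynomial.comp_aeval, ← MvPolynomial.coe_aeval_eq_eval]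
  have : (fun j => evalAt t ((pdRing hΩ 0)^[j] (res hf))) = fun j => ((pd 0)^[j] f) t := by
    funext j
    obtain ⟨h, e⟩ := iterate_pdRing_res hΩ hf j
    rw [e, evalAt_res]
  simp only [this]
  rfl

lemma conditionKdV_iff (hΩ : IsOpen Ω) (hv : ∀ k, 1 ≤ k → Holo Ω (v k)) :
    ConditionKdV Ω v ↔ ∃ a μ : ℕ → ℂ, muSeries a ^ 2 = muSeries μ ∧
      (∀ k, 1 ≤ k → pdRing hΩ k (seqRes hv 1) =
        diffHom (pdRing hΩ 0) (seqRes hv 1) (kdvRhs a k)) ∧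
      ∀ k, 2 ≤ k → seqRes hv k = diffHom (pdRing hΩ 0) (seqRes hv 1) (T μ k) := by
  have h1 : ∀ (p : DiffPoly) (t : Ω),
      evalAt t (diffHom (pdRing hΩ 0) (seqRes hv 1) p) = subst (v 1) p t := fun p t => by
    rw [seqRes_eq hv le_rfl, evalAt_diffHom]
  have hK : ∀ a, SolvesKdV Ω (v 1) a ↔ ∀ k, 1 ≤ k → pdRing hΩ k (seqRes hv 1) =
      diffHom (pdRing hΩ 0) (seqRes hv 1) (kdvRhs a k) := fun a => by
    refine forall_congr' fun k => forall_congr' fun hk => ?_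
    constructor
    · intro h
      exact holoRing_ext fun t => by
        rw [h1, evalAt_pdRing_seqRes hΩ hv k le_rfl]; exact h t t.2
    · intro h t ht
      have := congrArg (evalAt ⟨t, ht⟩) h
      rwa [h1, evalAt_pdRing_seqRes hΩ hv k le_rfl] at this
  have hT : ∀ μ, (∀ k, 2 ≤ k → ∀ t ∈ Ω, v k t = subst (v 1) (T μ k) t) ↔
      ∀ k, 2 ≤ k → seqRes hv k = diffHom (pdRing hΩ 0) (seqRes hv 1) (T μ k) := fun μ => by
    refine forall_congr' fun k => forall_congr' fun hk => ?_
    rw [seqRes_eq hv (by omega : 1 ≤ k)]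
    constructor
    · intro h
      exact holoRing_ext fun t => by rw [h1]; exact h t t.2
    · intro h t ht
      have := congrArg (evalAt ⟨t, ht⟩) h
      rwa [h1] at this
  simp only [ConditionKdV, hK, hT, ← muSeries_sq_iff]
  constructor
  · rintro ⟨a, h, μ, h', h''⟩
    exact ⟨a, μ, h', h, h''⟩
  · rintro ⟨a, μ, h', h, h''⟩
    exact ⟨a, h, μ, h', h''⟩

end Transfer

end KdV

end

/-- Equivalence of the commutation of `L, B₃, B₅, …`, of the generating function relation together
with `∂v₂/∂t_{2k+1} = ∂v_{2k+2}/∂t₁`, and of the parametric KdV hierarchy together with the recursion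
for the `v_{2k}`. Here `v k` stands for `v_{2k}`, `k ≥ 1`. -/
theorem mainTheorem3 (Ω : Set KdV.Times) (hΩ : IsOpen Ω) (hconn : IsConnected Ω)
    (v : ℕ → KdV.Times → ℂ) (hv : ∀ k, 1 ≤ k → KdV.Holo Ω (v k)) :
    List.TFAE [KdV.AllCommute Ω v, KdV.ConditionGen Ω v, KdV.ConditionKdV Ω v] := by
  have h12 : KdV.AllCommute Ω v ↔ KdV.ConditionGen Ω v := by
    rw [KdV.allCommute_iff hΩ hv, KdV.conditionGen_iff hΩ hv,
      KdV.exists_quadForm_eq_iff fun _ => KdV.exists_algebraMap_of_pdRing_eq_zero hΩ hconn]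
    exact KdV.ringCommute_iff (KdV.pdRing_comm hΩ) (KdV.pdRing_coordinate hΩ 0) _
  have h23 : KdV.ConditionGen Ω v ↔ KdV.ConditionKdV Ω v := by
    rw [KdV.conditionGen_iff hΩ hv, KdV.conditionKdV_iff hΩ hv]
    simp only [KdV.quadForm_eq_iff]
    constructor
    · rintro ⟨h, μ, hT⟩
      -- The parameters `a` of the hierarchy are obtained by extracting a square root of the series
      -- of `μ`.
      obtain ⟨a, ha⟩ := KdV.exists_muSeries_sq μ
      refine ⟨a, μ, ha, fun k hk => ?_, hT⟩
      rw [KdV.kdvRhs_eq ha hk, KdV.diffHom_dz, ← hT (k + 1) (by omega), h k hk]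
    · rintro ⟨a, μ, ha, h, hT⟩
      refine ⟨fun k hk => ?_, μ, hT⟩
      rw [h k hk, KdV.kdvRhs_eq ha hk, KdV.diffHom_dz, ← hT (k + 1) (by omega)]
  tfae_have 1 ↔ 2 := h12
  tfae_have 2 ↔ 3 := h23
  tfae_finish
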